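/- Let $G$ be a finite connected $4$-valent graph (loops and multiple edges allowed) with at least one vertex, embedded in the plane and regarded up to orientation-preserving homeomorphism of the plane. Opposite edges at a vertex are thought of as crossing there. A loop configuration in $G$ is a bounded face whose boundary consists of one edge (a loop at a vertex, with nothing inside). A bigon configuration is a bounded face whose boundary consists of exactly two edges joining two distinct vertices (two arcs that cross twice, with nothing in between). A simple triangle is a bounded face whose boundary consists of exactly three edges with three distinct corner vertices (three arcs that cross pairwise, with nothing in between). A triangle move replaces, inside a disc that contains a simple triangle and no other vertices, the picture of the three pairwise crossing arcs by the one obtained by sliding one arc over the crossing of the other two: if the six ends on the boundary of the disc are numbered $1,\dots,6$ in cyclic order and meet in pairs $12,34,56$ at the corners of the old triangle, they meet in pairs $23,45,61$ at the corners of the new one, $i$ and $i+3$ still being the ends of one arc; nothing changes outside the disc. If $G$ contains neither a loop configuration nor a bigon configuration, then a finite sequence of triangle moves turns $G$ into a connected plane $4$-valent graph that contains a bigon configuration. -/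

import Mathlib

/-- A finite 4-valent graph (loops and multiple edges allowed) drawn on a closed oriented surface
with simply connected faces, up to homeomorphism. `D` is the set of darts (an edge with one of its
two directions, regarded as issuing from its initial vertex), `rev` reverses a dart, and `rot`
sends a dart to the next dart, in clockwise order, issuing from the same vertex. Vertices are
the cycles of `rot`, each consisting of four darts; edges are the cycles of `rev`. -/
structure FourValentMap (D : Type*) where
  rot : Equiv.Perm D
  rev : Equiv.Perm D
  rev_rev : ∀ d, rev (rev d) = d
  rev_ne : ∀ d, rev d ≠ d
  rot_four : ∀ d, rot (rot (rot (rot d))) = d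
  rot_two_ne : ∀ d, rot (rot d) ≠ d

namespace FourValentMap

variable {D : Type*} (G : FourValentMap D)

/-- The next dart on the boundary of the face lying to the left of `d`: run along `d` and leave
its final vertex by the leftmost exit. -/
def next : Equiv.Perm D := G.rot * G.rev

/-- The vertices. -/
def Vertex : Type _ := Quotient (Equiv.Perm.SameCycle.setoid G.rot)

/-- The edges. -/
def Edge : Type _ := Quotient (Equiv.Perm.SameCycle.setoid G.rev)

/-- The faces. -/
def Face : Type _ := Quotient (Equiv.Perm.SameCycle.setoid G.next)

/-- The initial vertex of a dart. -/
def vertexOf (d : D) : G.Vertex := Quotient.mk (Equiv.Perm.SameCycle.setoid G.rot) d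

/-- The face to the left of a dart. -/
def faceOf (d : D) : G.Face := Quotient.mk (Equiv.Perm.SameCycle.setoid G.next) d

/-- Any two darts are joined by a sequence of the two operations `rot` and `rev`. -/
def Connected : Prop :=
  MulAction.IsPretransitive (Subgroup.closure ({G.rot, G.rev} : Set (Equiv.Perm D))) D

/-- The surface is a sphere (Euler's formula for a connected graph, `V - E + F = 2`). -/
def Spherical : Prop := Nat.card G.Vertex + Nat.card G.Face = Nat.card G.Edge + 2

end FourValentMap

/-- A connected 4-valent graph, having at least one vertex, embedded in the plane, up to
orientation preserving homeomorphism of the plane: a connected 4-valent graph on the sphere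
with one of its faces chosen as the unbounded one. -/
structure PlaneFourValentGraph (D : Type*) extends FourValentMap D where
  connected : toFourValentMap.Connected
  spherical : toFourValentMap.Spherical
  outer : toFourValentMap.Face

namespace PlaneFourValentGraph

variable {D : Type*} (G : PlaneFourValentGraph D)

/-- The dart `d` bounds a loop configuration: it is a loop with empty inside, that is, it is by
itself the whole boundary of a bounded face. -/
def IsLoop (d : D) : Prop := G.next d = d ∧ G.faceOf d ≠ G.outer

/-- The dart `d` lies on a bigon configuration: the face to its left is bounded, with exactly two
sides, joining two distinct vertices (so two arcs cross twice, with nothing in between). -/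
def IsBigon (d : D) : Prop :=
  G.next (G.next d) = d ∧ G.vertexOf d ≠ G.vertexOf (G.next d) ∧ G.faceOf d ≠ G.outer

/-- The dart `d` lies on a simple triangle: the face to its left is bounded, with exactly three
sides, and its three corners are distinct vertices (so three arcs cross pairwise, with nothing
in between). -/
def IsTriangle (d : D) : Prop :=
  G.next (G.next (G.next d)) = d ∧
  G.vertexOf d ≠ G.vertexOf (G.next d) ∧
  G.vertexOf (G.next d) ≠ G.vertexOf (G.next (G.next d)) ∧
  G.vertexOf (G.next (G.next d)) ≠ G.vertexOf d ∧
  G.faceOf d ≠ G.outer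

/-- `e` or its reverse is one of the three sides of the triangle to the left of `d`. -/
def IsSide (d e : D) : Prop :=
  e = d ∨ e = G.next d ∨ e = G.next (G.next d) ∨
  e = G.rev d ∨ e = G.rev (G.next d) ∨ e = G.rev (G.next (G.next d))

/-- The six darts issuing outwards from the corners of the triangle to the left of `d`, in
counterclockwise order around the triangle. The first two issue from the first corner, the next
two from the second, the last two from the third. -/
def legs (d : D) : List D :=
  let a := d
  let b := G.next d
  let c := G.next (G.next d)
  [G.rot (G.rot a), G.rot a, G.rot (G.rot b), G.rot b, G.rot (G.rot c), G.rot c]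

/-- Cyclic shift by one step of the six legs of the triangle; all other darts are fixed. -/
def shift [DecidableEq D] (d : D) : Equiv.Perm D := (G.legs d).formPerm

/-- `H` arises from `G` by a triangle move at the triangle to the left of `d`: an arc is slid over
the crossing of the two other arcs. Number the legs `1, …, 6` around the triangle. Before the move
they meet in pairs `12`, `34`, `56` at the three corners; afterwards they meet in pairs
`23`, `45`, `61` at the corners of the new triangle. So the edges are kept, and `rot` is conjugated
by the shift of the legs. Outside a disc containing the triangle the faces are unchanged, and the
unbounded face remains the same: a dart that is not a side of the triangle has the unbounded face
to its left after the move if and only if it had so before. -/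
def TriangleMoveAt [DecidableEq D] (G H : PlaneFourValentGraph D) (d : D) : Prop :=
  G.IsTriangle d ∧
  H.rev = G.rev ∧
  H.rot = G.shift d * G.rot * (G.shift d)⁻¹ ∧
  ∀ e, ¬ G.IsSide d e → (H.faceOf e = H.outer ↔ G.faceOf e = G.outer)

/-- `H` arises from `G` by one triangle move. -/
def TriangleMove [DecidableEq D] (G H : PlaneFourValentGraph D) : Prop :=
  ∃ d, G.TriangleMoveAt H d

end PlaneFourValentGraph

/-! A strand follows the graph by going straight on at every vertex. The proof works with regions,
that is, unions of faces. A disc is a nonempty region that is convex at every vertex (no reflex or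
opposite corners) and whose complement is connected and contains the unbounded face. A lens is a
disc with at most two corners. Strands are periodic, so each one returns to one of its vertices and
closes a loop. This loop bounds a region because the sphere has no first homology modulo 2, which
follows from Euler's formula by a rank count (`exists_face_chain`). If the strand enters the loop
from outside or closes up smoothly, the region is convex with at most one corner. Hence lenses exist
(`exists_convex_of_strand`, `exists_isMinimalLens`).

Let `S` be a lens with the fewest darts. Inside `S` strands have no self-crossings
(`IsMinimalLens.simple`). A chord of a disc `T ⊆ S` therefore separates `T`, and both pieces have at
least three corners, since otherwise filling a piece would give a smaller lens. Only two corners of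
a piece are new, namely those at the ends of the chord, so each piece keeps an old corner of `T`
(`IsMinimalLens.exists_piece`). If `S` contains neither loop nor bigon, a chord next to a corner of
`S` cuts off a triangular disc with one side along the boundary of `S`. Repeated cutting near the
corners on that side ends with a triangular face that has an edge on the boundary of `S`
(`IsMinimalLens.exists_triangle`).

A triangle move pushes this face out of `S`. What remains is a disc with no more corners and
strictly fewer darts; it is nonempty because `S` does not have three corners (`IsMove.moved`). A
loop can arise in a move only from a loop or a bigon already present (`IsMove.loop_cases`). So
induction on the size of a minimal lens applies (`exists_bigon_of_lens`), and the process stops only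
when a bigon is present. -/

namespace FourValentMap

/-! ### Strands, vertices, edges and faces -/

variable {D : Type*} (G : FourValentMap D)

theorem next_apply (d : D) : G.next d = G.rot (G.rev d) := rfl

theorem next_rev (d : D) : G.next (G.rev d) = G.rot d := by
  rw [next_apply, G.rev_rev]

theorem rot_ne (d : D) : G.rot d ≠ d := fun h => G.rot_two_ne d (by rw [h, h])

theorem rot_three_ne (d : D) : G.rot (G.rot (G.rot d)) ≠ d := fun h =>
  G.rot_ne d (by have := G.rot_four d; rwa [h] at this)

/-- Go straight on at the final vertex of a dart. -/
def straight : Equiv.Perm D := G.rot * G.rot * G.rev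

theorem straight_apply (d : D) : G.straight d = G.rot (G.rot (G.rev d)) := rfl

theorem rot_straight (d : D) : G.rot (G.rot (G.straight d)) = G.rev d := by
  rw [straight_apply, G.rot_four]

theorem straight_rev_straight (d : D) : G.straight (G.rev (G.straight d)) = G.rev d := by
  rw [straight_apply, G.rev_rev, rot_straight]

theorem straight_pow_succ (n : ℕ) (d : D) :
    (G.straight ^ (n + 1)) d = G.straight ((G.straight ^ n) d) := by
  rw [pow_succ', Equiv.Perm.mul_apply]

/-- A strand can be retraced: at a vertex, the reverse of going straight on is again going straight
on. -/
theorem straight_pow_rev (n : ℕ) (d : D) :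
    (G.straight ^ n) (G.rev ((G.straight ^ n) d)) = G.rev d := by
  induction n with
  | zero => simp
  | succ n ih =>
    rw [pow_succ, Equiv.Perm.mul_apply, ← pow_succ, straight_pow_succ, straight_rev_straight, ih]

/-- A strand never runs along an edge in both directions. -/
theorem straight_pow_ne_rev (n : ℕ) (d : D) : (G.straight ^ n) d ≠ G.rev d := by
  intro h
  -- Fold the strand at its midpoint. Retracing one half and cancelling a power of `straight` leaves
  -- a dart equal to its reverse, or one fixed by turning twice.
  obtain ⟨m, rfl | rfl⟩ := n.even_or_odd'
  · have h1 : (G.straight ^ m) ((G.straight ^ m) d) =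
        (G.straight ^ m) (G.rev ((G.straight ^ m) d)) := by
      rw [straight_pow_rev, ← h, two_mul, pow_add, Equiv.Perm.mul_apply]
    exact G.rev_ne _ ((Equiv.injective _ h1).symm)
  · have h1 : (G.straight ^ m) (G.straight ((G.straight ^ m) d)) =
        (G.straight ^ m) (G.rev ((G.straight ^ m) d)) := by
      rw [straight_pow_rev, ← h, ← straight_pow_succ, ← Equiv.Perm.mul_apply, ← pow_add]
      congr 2; omega
    exact G.rot_two_ne _ (Equiv.injective _ h1)

theorem straight_pow_ne_rev_pow (m n : ℕ) (d : D) :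
    (G.straight ^ m) d ≠ G.rev ((G.straight ^ n) d) := by
  intro h
  apply G.straight_pow_ne_rev (n + m) d
  rw [pow_add, Equiv.Perm.mul_apply, h, straight_pow_rev]

theorem exists_straight_pow_eq [Finite D] : ∃ N, 0 < N ∧ G.straight ^ N = 1 :=
  ⟨orderOf G.straight, orderOf_pos _, pow_orderOf_eq_one _⟩

theorem sameCycle_rot_iff (d e : D) : G.rot.SameCycle d e ↔
    e = d ∨ e = G.rot d ∨ e = G.rot (G.rot d) ∨ e = G.rot (G.rot (G.rot d)) := by
  constructor
  · rintro ⟨i, rfl⟩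
    induction i using Int.induction_on with
    | zero => simp
    | succ i ih =>
      rw [add_comm, zpow_add, Equiv.Perm.mul_apply, zpow_one]
      rcases ih with h | h | h | h <;> rw [h] <;> simp [G.rot_four]
    | pred i ih =>
      have key : ∀ x, G.rot⁻¹ x = G.rot (G.rot (G.rot x)) := fun x => by
        rw [Equiv.Perm.inv_eq_iff_eq, G.rot_four]
      rw [sub_eq_add_neg, add_comm, zpow_add, Equiv.Perm.mul_apply, zpow_neg_one, key]
      rcases ih with h | h | h | h <;> rw [h] <;> simp [G.rot_four]
  · have h1 : ∀ x, G.rot.SameCycle x (G.rot x) := fun x => ⟨1, by simp⟩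
    rintro (rfl | rfl | rfl | rfl)
    · rfl
    · exact h1 _
    · exact (h1 _).trans (h1 _)
    · exact ((h1 _).trans (h1 _)).trans (h1 _)

theorem vertexOf_eq_iff (d e : D) : G.vertexOf d = G.vertexOf e ↔
    e = d ∨ e = G.rot d ∨ e = G.rot (G.rot d) ∨ e = G.rot (G.rot (G.rot d)) := by
  rw [← sameCycle_rot_iff]
  exact Quotient.eq

theorem vertexOf_rot (d : D) : G.vertexOf (G.rot d) = G.vertexOf d :=
  ((G.vertexOf_eq_iff d (G.rot d)).2 (by simp)).symm

theorem vertexOf_straight (d : D) : G.vertexOf (G.straight d) = G.vertexOf (G.rev d) := by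
  rw [straight_apply, vertexOf_rot, vertexOf_rot]

theorem sameCycle_rev_iff (d e : D) : G.rev.SameCycle d e ↔ e = d ∨ e = G.rev d := by
  constructor
  · rintro ⟨i, rfl⟩
    induction i using Int.induction_on with
    | zero => simp
    | succ i ih =>
      rw [add_comm, zpow_add, Equiv.Perm.mul_apply, zpow_one]
      rcases ih with h | h <;> rw [h] <;> simp [G.rev_rev]
    | pred i ih =>
      have key : ∀ x, G.rev⁻¹ x = G.rev x := fun x => by
        rw [Equiv.Perm.inv_eq_iff_eq, G.rev_rev]
      rw [sub_eq_add_neg, add_comm, zpow_add, Equiv.Perm.mul_apply, zpow_neg_one, key]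
      rcases ih with h | h <;> rw [h] <;> simp [G.rev_rev]
  · rintro (rfl | rfl)
    · rfl
    · exact ⟨1, by simp⟩

/-- The edge of a dart. -/
def edgeOf (d : D) : G.Edge := Quotient.mk (Equiv.Perm.SameCycle.setoid G.rev) d

theorem edgeOf_eq_iff (d e : D) : G.edgeOf d = G.edgeOf e ↔ e = d ∨ e = G.rev d := by
  rw [← sameCycle_rev_iff]
  exact Quotient.eq

theorem faceOf_next (d : D) : G.faceOf (G.next d) = G.faceOf d :=
  Quotient.sound (s := Equiv.Perm.SameCycle.setoid G.next) (⟨-1, by simp⟩)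

theorem faceOf_eq_iff (d e : D) : G.faceOf d = G.faceOf e ↔ G.next.SameCycle d e :=
  Quotient.eq (r := Equiv.Perm.SameCycle.setoid G.next)

theorem vertexOf_surjective : Function.Surjective G.vertexOf := Quotient.exists_rep
theorem edgeOf_surjective : Function.Surjective G.edgeOf := Quotient.exists_rep
theorem faceOf_surjective : Function.Surjective G.faceOf := Quotient.exists_rep

instance [Finite D] : Finite G.Vertex := Finite.of_surjective _ G.vertexOf_surjective
instance [Finite D] : Finite G.Edge := Finite.of_surjective _ G.edgeOf_surjective
instance [Finite D] : Finite G.Face := Finite.of_surjective _ G.faceOf_surjective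

/-! ### Connectedness as a closure principle for sets of darts -/

variable {G}

/-- Closure under the inverses comes for free: an injective map of a finite set into itself is onto.
-/
theorem Connected.mem_of_closed [Finite D] (hc : G.Connected) {A : Set D}
    (hrot : ∀ d ∈ A, G.rot d ∈ A)
    (hrev : ∀ d ∈ A, G.rev d ∈ A) {d : D} (hd : d ∈ A) (e : D) : e ∈ A := by
  obtain ⟨⟨g, hg⟩, rfl⟩ := hc.exists_smul_eq d e
  have key : ∀ g ∈ Subgroup.closure ({G.rot, G.rev} : Set (Equiv.Perm D)), ∀ x, x ∈ A ↔ g x ∈ A := by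
    intro g hg
    induction hg using Subgroup.closure_induction with
    | mem g hg =>
      have hmaps : ∀ x ∈ A, g x ∈ A := by
        rcases hg with rfl | rfl
        · exact hrot
        · exact hrev
      intro x
      refine ⟨hmaps x, fun hx => ?_⟩
      have hsurj : Set.SurjOn g A A :=
        ((Set.toFinite A).injOn_iff_bijOn_of_mapsTo hmaps).1 g.injective.injOn |>.surjOn
      obtain ⟨y, hy, hxy⟩ := hsurj hx
      rwa [← g.injective hxy]
    | one => simp
    | mul a b _ _ ha hb => intro x; rw [Equiv.Perm.mul_apply, ← ha, ← hb]
    | inv a _ ha => intro x; rw [ha (a⁻¹ x)]; simp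
  exact (key g hg d).1 hd

theorem Connected.of_closed [Finite D]
    (h : ∀ A : Set D, (∀ d ∈ A, G.rot d ∈ A) → (∀ d ∈ A, G.rev d ∈ A) →
      ∀ d ∈ A, ∀ e, e ∈ A) : G.Connected := by
  refine ⟨fun x y => ?_⟩
  refine h {y | ∃ g : Subgroup.closure ({G.rot, G.rev} : Set (Equiv.Perm D)), g • x = y}
    ?_ ?_ x ⟨1, one_smul _ _⟩ y
  · rintro d ⟨g, rfl⟩
    exact ⟨⟨G.rot, Subgroup.subset_closure (by simp)⟩ * g, by rw [mul_smul]; rfl⟩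
  · rintro d ⟨g, rfl⟩
    exact ⟨⟨G.rev, Subgroup.subset_closure (by simp)⟩ * g, by rw [mul_smul]; rfl⟩

/-- Rotating a dart is reversing it and then running along the face. -/
theorem Connected.mem_of_closed_next [Finite D] (hc : G.Connected) {A : Set D}
    (hnext : ∀ d ∈ A, G.next d ∈ A) (hrev : ∀ d ∈ A, G.rev d ∈ A) {d : D} (hd : d ∈ A) (e : D) :
    e ∈ A :=
  hc.mem_of_closed (fun x hx => by rw [← next_rev]; exact hnext _ (hrev _ hx)) hrev hd e

/-! ### First homology modulo 2 of the sphere -/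

variable (G)

/-- A dart on a given edge. -/
noncomputable def dartOf (e : G.Edge) : D := Function.surjInv G.edgeOf_surjective e

theorem edgeOf_dartOf (e : G.Edge) : G.edgeOf (G.dartOf e) = e :=
  Function.surjInv_eq G.edgeOf_surjective e

theorem edgeOf_rev (d : D) : G.edgeOf (G.rev d) = G.edgeOf d :=
  ((G.edgeOf_eq_iff d _).2 (Or.inr rfl)).symm

theorem dartOf_edgeOf (d : D) :
    G.dartOf (G.edgeOf d) = d ∨ G.dartOf (G.edgeOf d) = G.rev d :=
  (G.edgeOf_eq_iff _ _).1 (G.edgeOf_dartOf _).symm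

open Classical in
theorem sum_dart_eq_sum_edge [Fintype D] [Fintype G.Edge] {M : Type*} [AddCommMonoid M]
    (f : D → M) :
    ∑ d, f d = ∑ e : G.Edge, (f (G.dartOf e) + f (G.rev (G.dartOf e))) := by
  rw [← Finset.sum_fiberwise (s := Finset.univ) (g := G.edgeOf)]
  refine Finset.sum_congr rfl fun e _ => ?_
  have : (Finset.univ.filter fun d => G.edgeOf d = e) =
      {G.dartOf e, G.rev (G.dartOf e)} := by
    ext d
    rw [Finset.mem_filter, Finset.mem_insert, Finset.mem_singleton, ← G.edgeOf_eq_iff,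
      edgeOf_dartOf]
    simp [eq_comm]
  rw [this, Finset.sum_pair (G.rev_ne _).symm]

open Classical in
/-- The incidence matrix modulo `2` between edges and the classes given by a labelling of darts. -/
noncomputable def incidence {ι : Type*} (p : D → ι) : Matrix G.Edge ι (ZMod 2) := fun e v =>
  (if p (G.dartOf e) = v then 1 else 0) + (if p (G.rev (G.dartOf e)) = v then 1 else 0)

theorem incidence_mulVecLin {ι : Type*} [Fintype ι] (p : D → ι) (ψ : ι → ZMod 2) (d : D) :
    (G.incidence p).mulVecLin ψ (G.edgeOf d) = ψ (p d) + ψ (p (G.rev d)) := by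
  classical
  have h1 : (G.incidence p).mulVecLin ψ (G.edgeOf d) = ψ (p (G.dartOf (G.edgeOf d))) +
      ψ (p (G.rev (G.dartOf (G.edgeOf d)))) := by
    simp [incidence, Matrix.mulVec, dotProduct, add_mul, Finset.sum_add_distrib]
  rw [h1]
  rcases G.dartOf_edgeOf d with h | h <;> rw [h]
  rw [G.rev_rev, add_comm]

open Classical in
-- While the incidence matrix is a coboundary, its transpose is a boundary operator. Summing over
-- darts counts an edge twice if both its ends have the label `v`, as it should.
theorem incidence_transpose_mulVecLin [Fintype D] [Fintype G.Edge] {ι : Type*} [Fintype ι]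
    (p : D → ι) (y : G.Edge → ZMod 2) (v : ι) :
    (G.incidence p).transpose.mulVecLin y v = ∑ x, if p x = v then y (G.edgeOf x) else 0 := by
  rw [G.sum_dart_eq_sum_edge]
  simp only [Matrix.mulVecLin_apply, Matrix.mulVec, dotProduct, Matrix.transpose_apply, incidence]
  refine Finset.sum_congr rfl fun e _ => ?_
  rw [edgeOf_rev, edgeOf_dartOf, add_mul, ite_mul, ite_mul, one_mul, zero_mul]

open Classical in
theorem sum_vertex_fiber [Fintype D] {M : Type*} [AddCommMonoid M] (f : D → M) (d : D) :
    ∑ x, (if G.vertexOf x = G.vertexOf d then f x else 0) =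
      f d + f (G.rot d) + f (G.rot (G.rot d)) + f (G.rot (G.rot (G.rot d))) := by
  rw [← Finset.sum_filter]
  have h1 := G.rot_ne
  have h2 := G.rot_two_ne
  have h3 := G.rot_three_ne
  have : (Finset.univ.filter fun x => G.vertexOf x = G.vertexOf d) =
      {d, G.rot d, G.rot (G.rot d), G.rot (G.rot (G.rot d))} := by
    ext x
    simp only [Finset.mem_filter, Finset.mem_univ, true_and, Finset.mem_insert,
      Finset.mem_singleton]
    rw [eq_comm, G.vertexOf_eq_iff]
  rw [this, Finset.sum_insert, Finset.sum_insert, Finset.sum_pair]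
  · simp only [add_assoc]
  · exact (h1 _).symm
  · simp only [Finset.mem_insert, Finset.mem_singleton, not_or]
    exact ⟨(h1 _).symm, (h2 _).symm⟩
  · simp only [Finset.mem_insert, Finset.mem_singleton, not_or]
    exact ⟨(h1 _).symm, (h2 _).symm, (h3 _).symm⟩

/-- A function in the kernel has equal values at both darts of every edge, so connectedness makes it
constant and the kernel is at most one-dimensional. This is used for vertices with `g = rot` and for
faces with `g = next`. -/
theorem card_le_finrank_range_incidence [Fintype G.Edge]
    {ι : Type*} [Fintype ι] {p : D → ι} (hp : p.Surjective) (g : Equiv.Perm D)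
    (hg : ∀ d, p (g d) = p d)
    (hclosed : ∀ A : Set D, (∀ d ∈ A, g d ∈ A) → (∀ d ∈ A, G.rev d ∈ A) → ∀ d ∈ A, ∀ e, e ∈ A)
    (d₀ : D) :
    Fintype.card ι ≤ Module.finrank (ZMod 2) (LinearMap.range (G.incidence p).mulVecLin) + 1 := by
  have h1 := (G.incidence p).mulVecLin.finrank_range_add_finrank_ker
  rw [Module.finrank_fintype_fun_eq_card] at h1
  have two : ∀ x y : ZMod 2, 0 = x + y → y = x := by decide
  have h2 : LinearMap.ker (G.incidence p).mulVecLin ≤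
      Submodule.span (ZMod 2) {fun _ : ι => (1 : ZMod 2)} := by
    intro ψ hψ
    rw [LinearMap.mem_ker] at hψ
    rw [Submodule.mem_span_singleton]
    refine ⟨ψ (p d₀), funext fun j => ?_⟩
    obtain ⟨d, rfl⟩ := hp j
    have key := hclosed {d | ψ (p d) = ψ (p d₀)} (fun d hd => by simpa [hg] using hd)
      (fun d hd => by
        have := G.incidence_mulVecLin p ψ d
        rw [hψ] at this
        exact (two _ _ this).trans hd) d₀ rfl d
    simpa using key.symm
  have h3 := (Submodule.finrank_mono h2).trans (finrank_span_le_card _)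
  simp only [Set.toFinset_singleton, Finset.card_singleton] at h3
  omega

open Classical in
/-- Every cycle modulo `2` on the sphere is the boundary of a set of faces. -/
theorem exists_face_chain [Finite D] (hc : G.Connected) (hs : G.Spherical)
    (z : D → ZMod 2) (hrev : ∀ d, z (G.rev d) = z d)
    (hcyc : ∀ d, z d + z (G.rot d) + z (G.rot (G.rot d)) + z (G.rot (G.rot (G.rot d))) = 0)
    (d₀ : D) :
    ∃ X : D → ZMod 2, (∀ d, X (G.next d) = X d) ∧ ∀ d, z d = X d + X (G.rev d) := by
  have := Fintype.ofFinite D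
  have := Fintype.ofFinite G.Vertex
  have := Fintype.ofFinite G.Edge
  have := Fintype.ofFinite G.Face
  have hrankM := G.card_le_finrank_range_incidence G.vertexOf_surjective G.rot G.vertexOf_rot
    (fun A h1 h2 d hd e => hc.mem_of_closed h1 h2 hd e) d₀
  have hrankN := G.card_le_finrank_range_incidence G.faceOf_surjective G.next G.faceOf_next
    (fun A h1 h2 d hd e => hc.mem_of_closed_next h1 h2 hd e) d₀
  set M := G.incidence G.vertexOf with hM
  set N := G.incidence G.faceOf with hN
  have hMt : ∀ (y : G.Edge → ZMod 2) (d : D), M.transpose.mulVecLin y (G.vertexOf d) =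
      y (G.edgeOf d) + y (G.edgeOf (G.rot d)) + y (G.edgeOf (G.rot (G.rot d))) +
        y (G.edgeOf (G.rot (G.rot (G.rot d)))) := fun y d => by
    rw [← G.sum_vertex_fiber (fun x => y (G.edgeOf x)), hM, incidence_transpose_mulVecLin]
  -- Boundaries of faces are cycles: each corner at a vertex touches two of the four darts there, so
  -- it cancels modulo 2.
  have hle : LinearMap.range N.mulVecLin ≤ LinearMap.ker M.transpose.mulVecLin := by
    rintro _ ⟨φ, rfl⟩
    rw [LinearMap.mem_ker]
    funext v
    obtain ⟨d, rfl⟩ := G.vertexOf_surjective v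
    have hf : ∀ x, G.faceOf (G.rev x) = G.faceOf (G.rot x) := fun x => by
      rw [← next_rev, faceOf_next]
    rw [hMt, hN, incidence_mulVecLin, incidence_mulVecLin, incidence_mulVecLin,
      incidence_mulVecLin, hf, hf, hf, hf, G.rot_four]
    have : ∀ a b c d : ZMod 2, a + b + (b + c) + (c + d) + (d + a) = 0 := by decide
    exact this _ _ _ _
  -- The cycles have dimension `E - rank M ≤ E - V + 1 = F - 1 ≤ rank N`; the equality in the middle
  -- is Euler's formula.
  have hdim : Module.finrank (ZMod 2) (LinearMap.ker M.transpose.mulVecLin) ≤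
      Module.finrank (ZMod 2) (LinearMap.range N.mulVecLin) := by
    have h1 := M.transpose.mulVecLin.finrank_range_add_finrank_ker
    have h2 := M.rank_transpose
    rw [Module.finrank_fintype_fun_eq_card] at h1
    unfold Matrix.rank at h2
    have h3 : Nat.card G.Vertex + Nat.card G.Face = Nat.card G.Edge + 2 := hs
    rw [Nat.card_eq_fintype_card, Nat.card_eq_fintype_card, Nat.card_eq_fintype_card] at h3
    omega
  have heq := Submodule.eq_of_le_of_finrank_le hle hdim
  have hzz : ∀ d, z (G.dartOf (G.edgeOf d)) = z d := by
    intro d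
    rcases G.dartOf_edgeOf d with h | h <;> rw [h]
    exact hrev d
  have hz : (fun e : G.Edge => z (G.dartOf e)) ∈ LinearMap.ker M.transpose.mulVecLin := by
    rw [LinearMap.mem_ker]
    funext v
    obtain ⟨d, rfl⟩ := G.vertexOf_surjective v
    rw [hMt, hzz, hzz, hzz, hzz, hcyc]
    rfl
  rw [← heq] at hz
  obtain ⟨φ, hφ⟩ := hz
  refine ⟨fun d => φ (G.faceOf d), fun d => by simp only [faceOf_next], fun d => ?_⟩
  simp only
  rw [← incidence_mulVecLin, ← hN, hφ]
  exact (hzz d).symm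

end FourValentMap

/-! ### Regions, and the regions bounded by loops of strands -/

namespace FourValentMap

variable {D : Type*} (G : FourValentMap D)

/-- A union of faces, given by the darts with these faces to their left. A dart `d` also stands for
the corner between `d` and the preceding dart at its initial vertex, and the corner on the
other side of `d` is `rot d`. -/
def IsRegion (X : Set D) : Prop := ∀ d, G.next d ∈ X ↔ d ∈ X

/-- At each vertex the corners belonging to the region are none, one, two adjacent ones or all. -/
def IsConvex (X : Set D) : Prop := ∀ d ∈ X, G.rot (G.rot d) ∈ X → G.rot d ∈ X

/-- The convex corners of a region. -/
def corners (X : Set D) : Set D := {d | d ∈ X ∧ G.rot d ∉ X ∧ G.rot (G.rot (G.rot d)) ∉ X}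

variable {G}

namespace IsRegion

variable {X Y : Set D}

/-- The two sides of an edge are the two corners next to it at its initial vertex. So the boundary
of a region can be read off at the vertices. -/
theorem rev_mem (hX : G.IsRegion X) (d : D) : G.rev d ∈ X ↔ G.rot d ∈ X := by
  rw [← hX (G.rev d), next_rev]

theorem compl (hX : G.IsRegion X) : G.IsRegion Xᶜ := fun d => not_congr (hX d)

theorem inter (hX : G.IsRegion X) (hY : G.IsRegion Y) : G.IsRegion (X ∩ Y) :=
  fun d => and_congr (hX d) (hY d)

theorem rot_straight_mem (hX : G.IsRegion X) (d : D) :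
    G.rot (G.rot (G.rot (G.straight d))) ∈ X ↔ d ∈ X := by
  rw [rot_straight, ← next_apply, hX]

end IsRegion

variable (G)

open Classical in
/-- The chain modulo `2` consisting of one edge. -/
noncomputable def edgeChain (d e : D) : ZMod 2 := if e = d ∨ e = G.rev d then 1 else 0

/-- The boundary of a chain of edges. -/
def boundary (z : D → ZMod 2) (d : D) : ZMod 2 :=
  z d + z (G.rot d) + z (G.rot (G.rot d)) + z (G.rot (G.rot (G.rot d)))

open Classical in
/-- The chain modulo `2` consisting of one vertex, as a function of the darts at vertices. -/
noncomputable def vertexChain (d e : D) : ZMod 2 := if G.vertexOf d = G.vertexOf e then 1 else 0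

theorem boundary_add (z w : D → ZMod 2) (d : D) :
    G.boundary (fun e => z e + w e) d = G.boundary z d + G.boundary w d := by
  simp only [boundary]; ring

theorem edgeChain_rev (d e : D) : G.edgeChain d (G.rev e) = G.edgeChain d e := by
  unfold edgeChain
  congr 1
  refine propext ⟨?_, ?_⟩
  · rintro (rfl | h)
    · exact Or.inr (G.rev_rev _).symm
    · exact Or.inl (G.rev.injective h)
  · rintro (rfl | rfl)
    · exact Or.inr rfl
    · exact Or.inl (G.rev_rev _)

theorem boundary_edgeChain [Finite D] (d e : D) :
    G.boundary (G.edgeChain d) e = G.vertexChain d e + G.vertexChain (G.rev d) e := by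
  classical
  have := Fintype.ofFinite D
  rw [boundary, ← G.sum_vertex_fiber]
  have h1 : ∀ x, (if G.vertexOf x = G.vertexOf e then G.edgeChain d x else 0) =
      (if x = d then G.vertexChain d e else 0) +
        (if x = G.rev d then G.vertexChain (G.rev d) e else 0) := by
    intro x
    unfold edgeChain vertexChain
    have := G.rev_ne d
    by_cases hx : x = d
    · subst hx
      simp [this.symm]
    · by_cases hx' : x = G.rev d
      · subst hx'
        simp [hx]
      · simp [hx, hx']
  simp_rw [h1, Finset.sum_add_distrib, Finset.sum_ite_eq', Finset.mem_univ, if_true]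

/-- The chain of the first `n` edges of the strand starting with `d`. -/
noncomputable def pathChain (d : D) (n : ℕ) (e : D) : ZMod 2 :=
  ∑ m ∈ Finset.range n, G.edgeChain ((G.straight ^ m) d) e

theorem pathChain_rev (d : D) (n : ℕ) (e : D) :
    G.pathChain d n (G.rev e) = G.pathChain d n e := by
  simp only [pathChain, edgeChain_rev]

theorem zmod_two_add_self (a : ZMod 2) : a + a = 0 := by revert a; decide

/-- The sum telescopes, since each edge of a strand ends where the next one begins. -/
theorem boundary_pathChain [Finite D] (d : D) (n : ℕ) (e : D) :
    G.boundary (G.pathChain d n) e =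
      G.vertexChain d e + G.vertexChain ((G.straight ^ n) d) e := by
  induction n with
  | zero => simp [pathChain, boundary, zmod_two_add_self]
  | succ n ih =>
    have h1 : G.pathChain d (n + 1) =
        fun x => G.pathChain d n x + G.edgeChain ((G.straight ^ n) d) x := by
      funext x
      exact Finset.sum_range_succ _ _
    have h2 : G.vertexChain (G.rev ((G.straight ^ n) d)) e =
        G.vertexChain ((G.straight ^ (n + 1)) d) e := by
      unfold vertexChain
      rw [straight_pow_succ, vertexOf_straight]
    rw [h1, boundary_add, ih, boundary_edgeChain, h2]
    have : ∀ a b c : ZMod 2, a + b + (b + c) = a + c := by decide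
    exact this _ _ _

/-- The dart lies, in one of its two directions, on the strand of `n` edges starting with `d`. -/
def OnPath (d : D) (n : ℕ) (e : D) : Prop :=
  ∃ m < n, e = (G.straight ^ m) d ∨ e = G.rev ((G.straight ^ m) d)

open Classical in
-- No edge cancels modulo 2: `hinj` forbids repetition in the same direction, and a strand never
-- runs back along itself.
theorem pathChain_eq (d : D) (n : ℕ)
    (hinj : ∀ m < n, ∀ m' < n, (G.straight ^ m) d = (G.straight ^ m') d → m = m') (e : D) :
    G.pathChain d n e = if G.OnPath d n e then 1 else 0 := by
  split_ifs with h
  · obtain ⟨m, hm, he⟩ := h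
    rw [pathChain, Finset.sum_eq_single m]
    · exact if_pos he
    · intro m' hm' hne
      refine if_neg fun he' => hne ?_
      rw [Finset.mem_range] at hm'
      rcases he with rfl | rfl <;> rcases he' with he' | he'
      · exact (hinj _ hm _ hm' he').symm
      · exact absurd he' (G.straight_pow_ne_rev_pow _ _ _)
      · exact absurd he'.symm (G.straight_pow_ne_rev_pow _ _ _)
      · exact (hinj _ hm _ hm' (G.rev.injective he')).symm
    · intro h
      exact absurd (Finset.mem_range.2 hm) h
  · exact Finset.sum_eq_zero fun m hm =>
      if_neg fun he => h ⟨m, Finset.mem_range.1 hm, he⟩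

theorem mem_iff_of_zmod (X : D → ZMod 2) (d e : D) :
    X d + X e = 1 ↔ ¬ (X d = 1 ↔ X e = 1) := by
  generalize X d = a
  generalize X e = b
  revert a b
  decide

/-- Every cycle modulo `2` bounds a region. -/
theorem exists_region_of_cycle [Finite D] (hc : G.Connected) (hs : G.Spherical)
    (z : D → ZMod 2) (hrev : ∀ d, z (G.rev d) = z d) (hcyc : ∀ d, G.boundary z d = 0) (o : D) :
    ∃ X : Set D, G.IsRegion X ∧ o ∉ X ∧ ∀ d, z d = 1 ↔ ¬ (d ∈ X ↔ G.rev d ∈ X) := by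
  obtain ⟨X, hX, hz⟩ := G.exists_face_chain hc hs z hrev hcyc o
  have hreg : G.IsRegion {d | X d = 1} := fun d => by
    simp only [Set.mem_ofPred_eq, hX]
  -- A region and its complement have the same boundary; the one without `o` is chosen.
  by_cases ho : X o = 1
  · refine ⟨{d | X d = 1}ᶜ, hreg.compl, by simpa using ho, fun d => ?_⟩
    rw [hz, mem_iff_of_zmod, Set.mem_compl_iff, Set.mem_compl_iff, not_iff_not, not_iff_not]
    rfl
  · refine ⟨{d | X d = 1}, hreg, ho, fun d => ?_⟩
    rw [hz, mem_iff_of_zmod]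
    rfl

/-- On a loop of a strand, two consecutive darts at a vertex only occur where it closes. -/
theorem onPath_rot_of_loop {c : D} {n : ℕ}
    (hinj : ∀ m < n, ∀ m' < n, G.vertexOf ((G.straight ^ m) c) = G.vertexOf ((G.straight ^ m') c) →
      m = m')
    (hclose : G.vertexOf ((G.straight ^ n) c) = G.vertexOf c) {e : D}
    (he : G.OnPath c n e) (he' : G.OnPath c n (G.rot e)) :
    (e = c ∧ G.rot e = G.rot (G.rot ((G.straight ^ n) c))) ∨
      (G.rot e = c ∧ e = G.rot (G.rot ((G.straight ^ n) c))) := by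
  -- Here `x` leaves a vertex and `y` is an arriving dart, reversed. Unless they are opposite, the
  -- strand does not pass from one to the other, so this is the vertex where the loop closes.
  have key : ∀ {x y : D} {m m' : ℕ}, m < n → m' < n → x = (G.straight ^ m) c →
      y = G.rev ((G.straight ^ m') c) → G.vertexOf x = G.vertexOf y → y ≠ G.rot (G.rot x) →
      x = c ∧ y = G.rot (G.rot ((G.straight ^ n) c)) := by
    intro x y m m' hm hm' hx hy hv hne
    rw [← rot_straight, ← straight_pow_succ] at hy
    have hv' : G.vertexOf ((G.straight ^ m) c) = G.vertexOf ((G.straight ^ (m' + 1)) c) := by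
      rw [← hx, hv, hy, vertexOf_rot, vertexOf_rot]
    rcases Nat.lt_or_ge (m' + 1) n with h | h
    · have := hinj _ hm _ h hv'
      exact absurd (by rw [hy, hx, this]) hne
    · obtain rfl : m' + 1 = n := by omega
      rw [hclose] at hv'
      obtain rfl := hinj m hm 0 (by omega) hv'
      exact ⟨hx, hy⟩
  have key2 : ∀ {x y : D} {m m' : ℕ}, m < n → m' < n → x = G.rev ((G.straight ^ m) c) →
      y = G.rev ((G.straight ^ m') c) → G.vertexOf x = G.vertexOf y → x = y := by
    intro x y m m' hm hm' hx hy hv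
    have hv' : G.vertexOf ((G.straight ^ (m + 1)) c) = G.vertexOf ((G.straight ^ (m' + 1)) c) := by
      rw [straight_pow_succ, straight_pow_succ, vertexOf_straight, vertexOf_straight, ← hx, hv, hy]
    have : m = m' := by
      rcases Nat.lt_or_ge (m + 1) n with h | h <;> rcases Nat.lt_or_ge (m' + 1) n with h' | h'
      · have := hinj _ h _ h' hv'; omega
      · obtain rfl : m' + 1 = n := by omega
        rw [hclose] at hv'
        have := hinj (m + 1) h 0 (by omega) hv'; omega
      · obtain rfl : m + 1 = n := by omega
        rw [hclose] at hv'
        have := hinj (m' + 1) h' 0 (by omega) hv'.symm; omega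
      · omega
    rw [hx, hy, this]
  have hv := (G.vertexOf_rot e).symm
  obtain ⟨m, hm, hx | hx⟩ := he <;> obtain ⟨m', hm', hy | hy⟩ := he'
  · rw [hy, hx] at hv
    obtain rfl := hinj _ hm _ hm' hv
    exact absurd (hy.trans hx.symm) (G.rot_ne e)
  · exact Or.inl (key hm hm' hx hy hv fun h => G.rot_ne _ h.symm)
  · refine Or.inr (key hm' hm hy hx hv.symm fun h => G.rot_three_ne e h.symm)
  · exact absurd (key2 hm hm' hx hy hv).symm (G.rot_ne e)

/-- A region bounded by a loop of a strand is convex with at most one corner, if the strand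
enters the loop from outside. -/
theorem isConvex_of_loop [Finite D] {c : D} {n : ℕ} (hn : 0 < n)
    (hinj : ∀ m < n, ∀ m' < n, G.vertexOf ((G.straight ^ m) c) = G.vertexOf ((G.straight ^ m') c) →
      m = m')
    (hclose : G.vertexOf ((G.straight ^ n) c) = G.vertexOf c) {X : Set D} (hX : G.IsRegion X)
    (hbd : ∀ e, G.OnPath c n e ↔ ¬ (e ∈ X ↔ G.rev e ∈ X))
    (hout : (G.straight ^ n) c = c ∨ G.rot (G.rot c) ∉ X) :
    G.IsConvex X ∧ X.Nonempty ∧ (G.corners X).ncard ≤ 1 := by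
  have hrot : ∀ e, G.OnPath c n e ↔ ¬ (e ∈ X ↔ G.rot e ∈ X) := fun e => by
    rw [hbd, hX.rev_mem]
  have hadj := fun e => G.onPath_rot_of_loop hinj hclose (e := e)
  refine ⟨?_, ?_, ?_⟩
  · intro e he he2
    by_contra he1
    have h0 : G.OnPath c n e := by rw [hrot]; tauto
    have h1 : G.OnPath c n (G.rot e) := by rw [hrot]; tauto
    have h2 : ¬ G.OnPath c n (G.rot (G.rot e)) := by
      intro h2
      have a1 := G.rot_ne e
      have a2 := G.rot_two_ne e
      have a3 := G.rot_ne (G.rot e)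
      rcases hadj e h0 h1 with ⟨b1, b2⟩ | ⟨b1, b2⟩ <;>
        rcases hadj _ h1 h2 with ⟨b3, b4⟩ | ⟨b3, b4⟩
      · exact a1 (b3.trans b1.symm)
      · exact a2 (b3.trans b1.symm)
      · exact a2 (b4.trans b2.symm)
      · exact a1 (b4.trans b2.symm)
    have h3 : G.rot (G.rot (G.rot e)) ∈ X := by
      rw [hrot] at h2; tauto
    -- Three of the four corners at the closing vertex would lie in `X`. In a smooth closing the two
    -- darts there would be opposite, not consecutive; otherwise `rot (rot c)` is one of the three
    -- corners.
    rcases hout with hout | hout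
    · rw [hout] at hadj
      rcases hadj e h0 h1 with ⟨b1, b2⟩ | ⟨b1, b2⟩
      · rw [← b1] at b2; exact G.rot_ne _ b2.symm
      · rw [← b1] at b2; exact G.rot_three_ne _ b2.symm
    · rcases hadj e h0 h1 with ⟨b1, b2⟩ | ⟨b1, b2⟩ <;> rw [← b1] at hout
      · exact hout he2
      · exact hout h3
  · have h0 : G.OnPath c n c := ⟨0, hn, Or.inl rfl⟩
    rw [hbd] at h0
    by_cases h : c ∈ X
    · exact ⟨c, h⟩
    · exact ⟨G.rev c, by tauto⟩
  · have hcor : ∀ e ∈ G.corners X, G.OnPath c n e ∧ G.OnPath c n (G.rot (G.rot (G.rot e))) := by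
      rintro e ⟨h1, h2, h3⟩
      refine ⟨(hrot e).2 (by tauto), (hrot _).2 ?_⟩
      rw [G.rot_four]; tauto
    have hcor' : ∀ e ∈ G.corners X, (G.rot (G.rot (G.rot e)) = c ∧ e = G.rot (G.rot ((G.straight ^ n) c))) ∨
        (e = c ∧ G.rot (G.rot (G.rot e)) = G.rot (G.rot ((G.straight ^ n) c))) := by
      intro e he
      obtain ⟨h1, h2⟩ := hcor e he
      have := hadj _ h2 (by rwa [G.rot_four])
      rwa [G.rot_four] at this
    rw [Set.ncard_le_one]
    intro e he e' he'
    rcases hcor' e he with ⟨a1, a2⟩ | ⟨a1, a2⟩ <;> rcases hcor' e' he' with ⟨b1, b2⟩ | ⟨b1, b2⟩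
    · rw [a2, b2]
    · exfalso
      have : e' = G.rot (G.rot (G.rot e)) := b1.trans a1.symm
      have h2 : G.rot (G.rot (G.rot e')) = e := b2.trans a2.symm
      rw [this, G.rot_four] at h2
      exact G.rot_two_ne _ h2
    · exfalso
      have : e = G.rot (G.rot (G.rot e')) := a1.trans b1.symm
      have h2 : G.rot (G.rot (G.rot e)) = e' := a2.trans b2.symm
      rw [this, G.rot_four] at h2
      exact G.rot_two_ne _ h2
    · rw [a1, b1]

/-- If a strand starting with `d` returns to one of its vertices for the first time, it bounds a
convex region with at most one corner, provided that `d` starts outside of the region. -/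
theorem exists_convex_of_return [Finite D] (hc : G.Connected) (hs : G.Spherical) {d o : D}
    {i j : ℕ} (hi : 1 ≤ i) (hij : i < j)
    (hinj : ∀ m m', 1 ≤ m → m < j → 1 ≤ m' → m' < j →
      G.vertexOf ((G.straight ^ m) d) = G.vertexOf ((G.straight ^ m') d) → m = m')
    (hclose : G.vertexOf ((G.straight ^ j) d) = G.vertexOf ((G.straight ^ i) d))
    (hd : ∀ X, G.IsRegion X → (∀ e ∈ X, G.rev e ∉ X →
      ∃ m, 1 ≤ m ∧ m < j ∧ (e = (G.straight ^ m) d ∨ e = G.rev ((G.straight ^ m) d))) →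
      o ∉ X → d ∉ X) :
    ∃ X, G.IsRegion X ∧ G.IsConvex X ∧ X.Nonempty ∧ (G.corners X).ncard ≤ 1 ∧ o ∉ X ∧
      ∀ e ∈ X, G.rev e ∉ X →
        ∃ m, 1 ≤ m ∧ m < j ∧ (e = (G.straight ^ m) d ∨ e = G.rev ((G.straight ^ m) d)) := by
  obtain ⟨n, rfl⟩ := Nat.exists_eq_add_of_lt hij
  set c := (G.straight ^ i) d with hcdef
  have hpow : ∀ m, (G.straight ^ m) c = (G.straight ^ (i + m)) d := fun m => by
    rw [hcdef, ← Equiv.Perm.mul_apply, ← pow_add, add_comm]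
  have hinj' : ∀ m < n + 1, ∀ m' < n + 1,
      G.vertexOf ((G.straight ^ m) c) = G.vertexOf ((G.straight ^ m') c) → m = m' := by
    intro m hm m' hm' h
    rw [hpow, hpow] at h
    have := hinj _ _ (by omega) (by omega) (by omega) (by omega) h
    omega
  have hclose' : G.vertexOf ((G.straight ^ (n + 1)) c) = G.vertexOf c := by
    rw [hpow, ← add_assoc]; exact hclose
  obtain ⟨X, hX, ho, hz⟩ := G.exists_region_of_cycle hc hs (G.pathChain c (n + 1))
    (G.pathChain_rev _ _) (fun e => by
      rw [boundary_pathChain]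
      unfold vertexChain
      rw [hclose']
      exact zmod_two_add_self _) o
  have hbd : ∀ e, G.OnPath c (n + 1) e ↔ ¬ (e ∈ X ↔ G.rev e ∈ X) := by
    intro e
    rw [← hz, pathChain_eq]
    · split_ifs with h <;> simp [h]
    · intro m hm m' hm' h
      exact hinj' m hm m' hm' (by rw [h])
  have hbd' : ∀ e ∈ X, G.rev e ∉ X → ∃ m, 1 ≤ m ∧ m < i + n + 1 ∧
      (e = (G.straight ^ m) d ∨ e = G.rev ((G.straight ^ m) d)) := by
    intro e he he'
    obtain ⟨m, hm, h⟩ := (hbd e).2 (by tauto)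
    rw [hpow] at h
    exact ⟨i + m, by omega, by omega, h⟩
  have hdX := hd X hX hbd' ho
  have hout : (G.straight ^ (n + 1)) c = c ∨ G.rot (G.rot c) ∉ X := by
    by_contra hcon
    push Not at hcon
    obtain ⟨hne, hmem⟩ := hcon
    have hoff : ∀ m < i, ¬ G.OnPath c (n + 1) ((G.straight ^ m) d) := by
      rintro m hm ⟨m', hm', h | h⟩
      · rw [hpow] at h
        -- `hinj` does not cover the initial vertex of `d`, so the case `m = 0` is compared one step
        -- later: either two vertices coincide too early, or the loop closes smoothly against `hne`.
        rcases Nat.eq_zero_or_pos m with rfl | hm0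
        · have h1 : (G.straight ^ 1) d = (G.straight ^ (i + m' + 1)) d := by
            rw [straight_pow_succ _ (i + m'), ← h]; simp
          rcases Nat.lt_or_ge m' n with h2 | h2
          · have := hinj 1 (i + m' + 1) le_rfl (by omega) (by omega) (by omega) (by rw [h1])
            omega
          · obtain rfl : m' = n := by omega
            have h3 := hinj 1 i le_rfl (by omega) hi (by omega) (by rw [h1]; exact hclose)
            apply hne
            rw [hpow, ← add_assoc, ← h1, hcdef, ← h3]
        · have := hinj _ _ hm0 (by omega) (by omega) (by omega) (congrArg G.vertexOf h)
          omega
      · rw [hpow] at h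
        exact G.straight_pow_ne_rev_pow _ _ _ h
    have hrevmem : ∀ m < i, (G.straight ^ m) d ∉ X → G.rev ((G.straight ^ m) d) ∉ X := by
      intro m hm h
      have := hoff m hm
      rw [hbd] at this
      tauto
    have hall : ∀ m < i, (G.straight ^ m) d ∉ X := by
      intro m
      induction m with
      | zero => intro _; exact hdX
      | succ m ih =>
        intro hm
        have h1 := hrevmem m (by omega) (ih (by omega))
        have hoffv : ∀ e, G.vertexOf ((G.straight ^ (m + 1)) d) = G.vertexOf e →
            ¬ G.OnPath c (n + 1) e := by
          rintro e hv ⟨m', hm', rfl | rfl⟩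
          · rw [hpow] at hv
            have := hinj _ _ (by omega) (by omega) (by omega) (by omega) hv
            omega
          · rw [← vertexOf_straight, ← straight_pow_succ, hpow] at hv
            rcases Nat.lt_or_ge m' n with h2 | h2
            · have := hinj _ _ (by omega) (by omega) (by omega) (by omega) hv
              omega
            · obtain rfl : m' = n := by omega
              have := hinj (m + 1) i (by omega) (by omega) hi (by omega) (hv.trans hclose)
              omega
        have hstep : ∀ e, G.vertexOf ((G.straight ^ (m + 1)) d) = G.vertexOf e → e ∉ X →
            G.rot e ∉ X := by
          intro e hv he
          have := hoffv e hv
          rw [hbd, hX.rev_mem] at this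
          tauto
        have hv : G.vertexOf ((G.straight ^ (m + 1)) d) =
            G.vertexOf (G.rev ((G.straight ^ m) d)) := by
          rw [straight_pow_succ, vertexOf_straight]
        have h2 := hstep _ hv h1
        have h3 := hstep _ (hv.trans (G.vertexOf_rot _).symm) h2
        rwa [← straight_apply, ← straight_pow_succ] at h3
    obtain ⟨k, rfl⟩ : ∃ k, i = k + 1 := ⟨i - 1, by omega⟩
    rw [hcdef, straight_pow_succ, rot_straight] at hmem
    exact hrevmem k (by omega) (hall k (by omega)) hmem
  obtain ⟨h1, h2, h3⟩ := G.isConvex_of_loop (Nat.succ_pos n) hinj' hclose' hX hbd hout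
  exact ⟨X, hX, h1, h2, h3, ho, hbd'⟩

/-- A strand returns to one of its vertices. -/
theorem exists_first_return [Finite D] (d : D) : ∃ i j, 1 ≤ i ∧ i < j ∧
    (∀ m m', 1 ≤ m → m < j → 1 ≤ m' → m' < j →
      G.vertexOf ((G.straight ^ m) d) = G.vertexOf ((G.straight ^ m') d) → m = m') ∧
    G.vertexOf ((G.straight ^ j) d) = G.vertexOf ((G.straight ^ i) d) := by
  classical
  have hex : ∃ j i, 1 ≤ i ∧ i < j ∧
      G.vertexOf ((G.straight ^ j) d) = G.vertexOf ((G.straight ^ i) d) := by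
    obtain ⟨N, hN, h⟩ := G.exists_straight_pow_eq
    refine ⟨N + 1, 1, le_rfl, by omega, ?_⟩
    rw [pow_succ, h, one_mul, pow_one]
  obtain ⟨i, hi, hij, h⟩ := Nat.find_spec hex
  refine ⟨i, Nat.find hex, hi, hij, ?_, h⟩
  intro m m' hm hmj hm' hmj' hv
  rcases lt_trichotomy m m' with hlt | heq | hlt
  · exact absurd ⟨m, hm, hlt, hv.symm⟩ (Nat.find_min hex hmj')
  · exact heq
  · exact absurd ⟨m', hm', hlt, hv⟩ (Nat.find_min hex hmj)

/-- The union of the faces that can be reached from `o` without crossing the strand of `d`. -/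
def strandComponent (d o : D) : Set D :=
  {e | ∀ X, G.IsRegion X → o ∈ X →
    (∀ x ∈ X, G.rev x ∉ X → ∃ m, x = (G.straight ^ m) d ∨ x = G.rev ((G.straight ^ m) d)) → e ∈ X}

/-- Every strand bounds a convex region with at most one corner, away from a given face. -/
theorem exists_convex_of_strand [Finite D] (hc : G.Connected) (hs : G.Spherical) (d o : D) :
    ∃ X, G.IsRegion X ∧ G.IsConvex X ∧ X.Nonempty ∧ (G.corners X).ncard ≤ 1 ∧ o ∉ X ∧
      ∀ e ∈ X, G.rev e ∉ X → ∃ m, e = (G.straight ^ m) d ∨ e = G.rev ((G.straight ^ m) d) := by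
  have hmain : ∀ d' : D, (∀ m, ∃ m', (G.straight ^ m) d' = (G.straight ^ m') d ∨
      (G.straight ^ m) d' = G.rev ((G.straight ^ m') d)) → d' ∈ G.strandComponent d o →
      ∃ X, G.IsRegion X ∧ G.IsConvex X ∧ X.Nonempty ∧ (G.corners X).ncard ≤ 1 ∧ o ∉ X ∧
      ∀ e ∈ X, G.rev e ∉ X → ∃ m, e = (G.straight ^ m) d ∨ e = G.rev ((G.straight ^ m) d) := by
    intro d' hd' hK
    have hconv : ∀ e, (∃ m, e = (G.straight ^ m) d' ∨ e = G.rev ((G.straight ^ m) d')) →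
        ∃ m, e = (G.straight ^ m) d ∨ e = G.rev ((G.straight ^ m) d) := by
      rintro e ⟨m, rfl | rfl⟩ <;> obtain ⟨m', h | h⟩ := hd' m <;> refine ⟨m', ?_⟩ <;> rw [h]
      · exact Or.inl rfl
      · exact Or.inr rfl
      · exact Or.inr rfl
      · exact Or.inl (G.rev_rev _)
    obtain ⟨i, j, hi, hij, hinj, hclose⟩ := G.exists_first_return d'
    -- The complement of a region bounded by the strand and missing `o` contains all that is
    -- reachable from `o` without crossing the strand, in particular `d'`.
    obtain ⟨X, h1, h2, h3, h4, h5, h6⟩ :=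
      G.exists_convex_of_return hc hs (o := o) hi hij hinj hclose (fun X hX hbd ho hdX => by
        refine hK Xᶜ hX.compl ho (fun x hx hx' => ?_) hdX
        rw [Set.notMem_compl_iff] at hx'
        obtain ⟨m, -, -, h⟩ := hbd (G.rev x) hx' (by rwa [G.rev_rev])
        obtain ⟨m', h⟩ := hconv _ ⟨m, h⟩
        refine ⟨m', ?_⟩
        rcases h with h | h
        · exact Or.inr (by rw [← h, G.rev_rev])
        · exact Or.inl (G.rev.injective h))
    refine ⟨X, h1, h2, h3, h4, h5, fun e he he' => ?_⟩
    obtain ⟨m, -, -, h⟩ := h6 e he he'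
    exact hconv e ⟨m, h⟩
  by_cases hmeet : ∃ m, (G.straight ^ m) d ∈ G.strandComponent d o ∨
      G.rev ((G.straight ^ m) d) ∈ G.strandComponent d o
  · obtain ⟨m, h | h⟩ := hmeet
    · exact hmain _ (fun m' => ⟨m' + m, Or.inl (by rw [pow_add, Equiv.Perm.mul_apply])⟩) h
    · refine hmain _ (fun m' => ?_) h
      obtain ⟨N, hN, hN1⟩ := G.exists_straight_pow_eq
      -- The exponent `m + (N - 1) * m'` stands for `m - m'` modulo the period `N`.
      have h1 : (G.straight ^ m) d = (G.straight ^ m') ((G.straight ^ (m + (N - 1) * m')) d) := by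
        rw [← Equiv.Perm.mul_apply, ← pow_add]
        have : m' + (m + (N - 1) * m') = m + N * m' := by
          obtain ⟨k, rfl⟩ : ∃ k, N = k + 1 := ⟨N - 1, by omega⟩
          simp only [Nat.add_sub_cancel]; ring
        rw [this, pow_add, pow_mul, hN1, one_pow, mul_one]
      refine ⟨m + (N - 1) * m', Or.inr ?_⟩
      rw [h1, straight_pow_rev]
  -- If no dart of the strand, in either direction, lay in the component of `o`, this component
  -- would have no boundary and be everything.
  · exfalso
    push Not at hmeet
    have hnext : ∀ e ∈ G.strandComponent d o, G.next e ∈ G.strandComponent d o :=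
      fun e he X hX ho hbd => (hX e).2 (he X hX ho hbd)
    have hrev : ∀ e ∈ G.strandComponent d o, G.rev e ∈ G.strandComponent d o := by
      intro e he X hX ho hbd
      by_contra hcon
      obtain ⟨m, rfl | rfl⟩ := hbd e (he X hX ho hbd) hcon
      · exact (hmeet m).1 he
      · exact (hmeet m).2 he
    exact (hmeet 0).1 (hc.mem_of_closed_next hnext hrev (d := o) (fun X _ ho _ => ho) _)

end FourValentMap

/-! ### Discs and minimal lenses -/

namespace FourValentMap

variable {D : Type*} (G : FourValentMap D)

/-- The complement of the region is connected. -/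
def IsCoconnected (T : Set D) : Prop :=
  ∀ X, G.IsRegion X → (∀ d ∈ X, d ∉ T → G.rev d ∉ T → G.rev d ∈ X) →
    ∀ d ∈ X, d ∉ T → ∀ e, e ∉ T → e ∈ X

/-- The region together with all components of its complement except the one containing `o`. -/
def fill (o : D) (T : Set D) : Set D :=
  {e | ∃ X, G.IsRegion X ∧ o ∈ X ∧ (∀ x ∈ X, G.rev x ∉ T → G.rev x ∈ X) ∧ e ∉ X}

/-- A nonempty convex region with connected complement, this complement containing `o`. -/
structure IsDisc (o : D) (T : Set D) : Prop where
  region : G.IsRegion T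
  convex : G.IsConvex T
  nonempty : T.Nonempty
  coconnected : G.IsCoconnected T
  notMem : o ∉ T

/-- A smallest disc with at most two corners. -/
structure IsMinimalLens (o : D) (S : Set D) : Prop extends G.IsDisc o S where
  ncard_corners : (G.corners S).ncard ≤ 2
  minimal : ∀ T, G.IsDisc o T → (G.corners T).ncard ≤ 2 → S.ncard ≤ T.ncard

variable {G}

section fill

variable {o : D} {T S : Set D}

theorem subset_fill (hT : G.IsRegion T) (ho : o ∉ T) : T ⊆ G.fill o T := fun _ he =>
  ⟨Tᶜ, hT.compl, ho, fun _ _ h => h, fun h => h he⟩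

theorem notMem_fill : o ∉ G.fill o T := fun ⟨_, _, ho, _, h⟩ => h ho

theorem isRegion_fill : G.IsRegion (G.fill o T) := fun d => by
  constructor <;> rintro ⟨X, hX, ho, hcl, h⟩
  · exact ⟨X, hX, ho, hcl, fun h' => h ((hX d).2 h')⟩
  · exact ⟨X, hX, ho, hcl, fun h' => h ((hX d).1 h')⟩

theorem rev_notMem_fill {e : D} (he : e ∉ G.fill o T) (he' : G.rev e ∉ T) :
    G.rev e ∉ G.fill o T := by
  rintro ⟨X, hX, ho, hcl, h⟩
  refine h (hcl e ?_ he')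
  by_contra hcon
  exact he ⟨X, hX, ho, hcl, hcon⟩

/-- Filling creates no new boundary: an added component of the complement can be left only through
the boundary of `T`. -/
theorem mem_of_boundary_fill {e : D} (he : e ∈ G.fill o T) (he' : G.rev e ∉ G.fill o T) :
    e ∈ T := by
  by_contra h
  have := rev_notMem_fill he' (by rwa [G.rev_rev])
  rw [G.rev_rev] at this
  exact this he

theorem mem_of_rot_notMem_fill {e : D} (he : e ∈ G.fill o T) (he' : G.rot e ∉ G.fill o T) :
    e ∈ T :=
  mem_of_boundary_fill he (by rwa [isRegion_fill.rev_mem])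

theorem rot_mem_of_notMem_fill (hT : G.IsRegion T) {e : D} (he : e ∉ G.fill o T)
    (he' : G.rot e ∈ G.fill o T) : G.rot e ∈ T := by
  rw [← hT.rev_mem]
  refine mem_of_boundary_fill (o := o) ?_ (by rwa [G.rev_rev])
  rwa [isRegion_fill.rev_mem]

/-- If the middle corner were missing, both edges next to it would be boundary edges of the filling.
The two outer corners would then belong to `T`, whose convexity supplies the middle one. -/
theorem isConvex_fill (hT : G.IsRegion T) (hconv : G.IsConvex T) (ho : o ∉ T) :
    G.IsConvex (G.fill o T) := by
  intro e he he2
  by_contra he1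
  have h0 := mem_of_rot_notMem_fill he he1
  have h2 := rot_mem_of_notMem_fill hT he1 he2
  exact he1 (subset_fill hT ho (hconv e h0 h2))

theorem corners_fill_subset (hT : G.IsRegion T) (ho : o ∉ T) :
    G.corners (G.fill o T) ⊆ G.corners T := fun _ ⟨h1, h2, h3⟩ =>
  ⟨mem_of_rot_notMem_fill h1 h2, fun h => h2 (subset_fill hT ho h),
    fun h => h3 (subset_fill hT ho h)⟩

/-- A union of components of the complement that contains `o` is itself an admissible witness in
`fill`, hence all of the complement. If it does not contain `o`, its complement is used instead. -/
theorem isCoconnected_fill : G.IsCoconnected (G.fill o T) := by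
  have key : ∀ X, G.IsRegion X →
      (∀ d ∈ X, d ∉ G.fill o T → G.rev d ∉ G.fill o T → G.rev d ∈ X) → o ∈ X →
      ∀ e, e ∉ G.fill o T → e ∈ X := by
    intro X hX hcl ho e he
    by_contra heX
    refine he ⟨X ∩ (G.fill o T)ᶜ, hX.inter isRegion_fill.compl, ⟨ho, notMem_fill⟩,
      fun x hx hx' => ?_, fun h => heX h.1⟩
    have := rev_notMem_fill hx.2 hx'
    exact ⟨hcl x hx.1 hx.2 this, this⟩
  intro X hX hcl d hd hd' e he
  by_cases ho : o ∈ X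
  · exact key X hX hcl ho e he
  · refine absurd hd (key Xᶜ hX.compl (fun x hx hx1 hx2 hx3 => ?_) ho d hd')
    have := hcl _ hx3 hx2 (by rwa [G.rev_rev])
    rw [G.rev_rev] at this
    exact hx this

theorem isDisc_fill (hT : G.IsRegion T) (hconv : G.IsConvex T) (hne : T.Nonempty) (ho : o ∉ T) :
    G.IsDisc o (G.fill o T) :=
  ⟨isRegion_fill, isConvex_fill hT hconv ho, hne.mono (subset_fill hT ho), isCoconnected_fill,
    notMem_fill⟩

/-- The complement of `S` is connected, contains `o` and avoids `T`, so it lies in the one component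
that is not filled. -/
theorem fill_subset (hS : G.IsDisc o S) (hTS : T ⊆ S) : G.fill o T ⊆ S := by
  rintro e ⟨X, hX, ho, hcl, h⟩
  by_contra he
  exact h (hS.coconnected X hX (fun d hd _ hd2 => hcl d hd fun h' => hd2 (hTS h')) o ho
    hS.notMem e he)

end fill

theorem ncard_corners_fill_le [Finite D] {o : D} {T : Set D} (hT : G.IsRegion T) (ho : o ∉ T) :
    (G.corners (G.fill o T)).ncard ≤ (G.corners T).ncard :=
  Set.ncard_le_ncard (corners_fill_subset hT ho)

/-- There is a smallest lens. -/
theorem exists_isMinimalLens [Finite D] {o : D} {T : Set D} (hT : G.IsRegion T)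
    (hconv : G.IsConvex T) (hne : T.Nonempty) (ho : o ∉ T) (hcard : (G.corners T).ncard ≤ 2) :
    ∃ S, G.IsMinimalLens o S ∧ S.ncard ≤ (G.fill o T).ncard := by
  classical
  have hex : ∃ n, ∃ S : Set D, G.IsDisc o S ∧ (G.corners S).ncard ≤ 2 ∧ S.ncard = n :=
    ⟨_, G.fill o T, isDisc_fill hT hconv hne ho, (ncard_corners_fill_le hT ho).trans hcard, rfl⟩
  obtain ⟨S, h1, h2, h3⟩ := Nat.find_spec hex
  refine ⟨S, ⟨h1, h2, fun T' hT' hc' => ?_⟩, ?_⟩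
  · rw [h3]
    exact Nat.find_min' hex ⟨T', hT', hc', rfl⟩
  · rw [h3]
    exact Nat.find_min' hex
      ⟨_, isDisc_fill hT hconv hne ho, (ncard_corners_fill_le hT ho).trans hcard, rfl⟩

theorem IsDisc.exists_boundary [Finite D] (hc : G.Connected) {o : D} {S : Set D}
    (hS : G.IsDisc o S) : ∃ b ∈ S, G.rev b ∉ S := by
  by_contra! hcon
  obtain ⟨d, hd⟩ := hS.nonempty
  exact hS.notMem (hc.mem_of_closed_next (fun d hd => (hS.region d).2 hd) hcon hd o)

/-- A convex region in a disc inside a minimal lens has at least three corners, unless it has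
all of the boundary of the disc. -/
theorem IsMinimalLens.three_le [Finite D] {o : D} {S T T' : Set D} (hS : G.IsMinimalLens o S)
    (hT : G.IsDisc o T) (hTS : T ⊆ S) (hsub : T' ⊆ T) (hreg : G.IsRegion T')
    (hconv : G.IsConvex T') (hne : T'.Nonempty) {b : D} (hb : b ∈ T) (hb' : G.rev b ∉ T)
    (hb'' : b ∉ T') : 3 ≤ (G.corners (G.fill o T')).ncard := by
  by_contra hcon
  have ho : o ∉ T' := fun h => hT.notMem (hsub h)
  have h1 := fill_subset hT hsub
  have h2 := hS.minimal _ (isDisc_fill hreg hconv hne ho) (by omega)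
  have h3 : G.fill o T' = S := Set.eq_of_subset_of_ncard_le (h1.trans hTS) h2
  have h4 : T = S := hTS.antisymm (h3 ▸ h1)
  subst h4
  exact hb'' (mem_of_boundary_fill (h3 ▸ hb) (h3 ▸ hb'))

/-- The connected complement of `S` starts outside `X` at `o` and meets no edge of the boundary of
`X`. -/
theorem IsDisc.subset_of_boundary {o : D} {S X : Set D} (hS : G.IsDisc o S) (hX : G.IsRegion X)
    (ho : o ∉ X) (hbd : ∀ e ∈ X, G.rev e ∉ X → e ∈ S ∧ G.rev e ∈ S) : X ⊆ S := by
  intro e he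
  by_contra heS
  refine hS.coconnected Xᶜ hX.compl (fun d hd hd1 hd2 hd3 => ?_) o ho hS.notMem e heS he
  exact hd2 (hbd _ hd3 (by rwa [G.rev_rev])).1

/-- No convex region with at most one corner is bounded by interior edges of a minimal lens. -/
theorem IsMinimalLens.not_isConvex [Finite D] (hc : G.Connected) {o : D} {S X : Set D}
    (hS : G.IsMinimalLens o S) (hX : G.IsRegion X) (hconv : G.IsConvex X) (hne : X.Nonempty)
    (hcard : (G.corners X).ncard ≤ 1) (ho : o ∉ X)
    (hbd : ∀ e ∈ X, G.rev e ∉ X → e ∈ S ∧ G.rev e ∈ S) : False := by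
  have hsub := hS.subset_of_boundary hX ho hbd
  obtain ⟨b, hb, hb'⟩ := hS.exists_boundary hc
  have := hS.three_le hS.toIsDisc subset_rfl hsub hX hconv hne hb hb'
    (fun h => hb' (hbd b h fun h' => hb' (hsub h')).2)
  have := ncard_corners_fill_le hX ho
  omega

section

variable {T : Set D}

/-- The corners to the right of the incoming edge and to the left of the outgoing edge are opposite,
so convexity supplies the corner to the right of the outgoing edge. Thus the right side of a strand
stays in `T` as long as its left side does. -/
theorem rev_straight_mem (hT : G.IsRegion T) (hconv : G.IsConvex T) {d : D}
    (hd' : G.rev d ∈ T) (h : G.straight d ∈ T) : G.rev (G.straight d) ∈ T := by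
  rw [hT.rev_mem]
  refine hconv _ h ?_
  rwa [rot_straight]

theorem rev_straight_pow_mem (hT : G.IsRegion T) (hconv : G.IsConvex T) {d : D} {n : ℕ}
    (hd' : G.rev d ∈ T) (h : ∀ m < n, (G.straight ^ m) d ∈ T) :
    ∀ m < n, G.rev ((G.straight ^ m) d) ∈ T := by
  intro m
  induction m with
  | zero => intro _; exact hd'
  | succ m ih =>
    intro hm
    have h1 := h _ hm
    rw [straight_pow_succ] at h1 ⊢
    exact rev_straight_mem hT hconv (ih (by omega)) h1

theorem rot_three_notMem (hconv : G.IsConvex T) {d : D} (h1 : G.rot d ∈ T)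
    (h2 : G.rot (G.rot d) ∉ T) : G.rot (G.rot (G.rot d)) ∉ T := fun h => h2 (hconv _ h1 h)

end

/-- The strand of an interior edge of a minimal lens, followed backwards, reaches the boundary. -/
theorem IsMinimalLens.exists_start [Finite D] (hc : G.Connected) (hs : G.Spherical) {o : D}
    {S : Set D} (hS : G.IsMinimalLens o S) {d : D} (hd : d ∈ S) (hd' : G.rev d ∈ S) :
    ∃ e k, (G.straight ^ k) e = d ∧ e ∈ S ∧ G.rev e ∈ S ∧ G.rot (G.rot e) ∉ S ∧
      ∀ m ≤ k, (G.straight ^ m) e ∈ S := by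
  by_contra hcon
  -- Otherwise the strand can be followed backwards in `S` forever. Being periodic it consists of
  -- interior edges, and the region with at most one corner that it bounds contradicts minimality.
  have key : ∀ n, ∃ e, (G.straight ^ n) e = d ∧ e ∈ S ∧ G.rev e ∈ S ∧
      ∀ m ≤ n, (G.straight ^ m) e ∈ S := by
    intro n
    induction n with
    | zero =>
      refine ⟨d, rfl, hd, hd', fun m hm => ?_⟩
      obtain rfl : m = 0 := by omega
      exact hd
    | succ n ih =>
      obtain ⟨e, he, he1, he2, he3⟩ := ih
      obtain ⟨f, rfl⟩ := G.straight.surjective e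
      have hrf : G.rev f ∈ S := by
        by_contra h
        rw [← rot_straight] at h
        exact hcon ⟨_, n, he, he1, he2, h, he3⟩
      have h3 : G.rot (G.rev f) ∈ S := by
        rw [← rot_straight] at hrf ⊢
        refine hS.convex _ hrf ?_
        rwa [G.rot_four]
      have hf : f ∈ S := by rwa [← next_apply, hS.region] at h3
      refine ⟨f, ?_, hf, hrf, fun m hm => ?_⟩
      · rw [pow_succ, Equiv.Perm.mul_apply, he]
      · rcases Nat.eq_zero_or_pos m with rfl | h0
        · exact hf
        · obtain ⟨m, rfl⟩ : ∃ k, m = k + 1 := ⟨m - 1, by omega⟩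
          rw [pow_succ, Equiv.Perm.mul_apply]
          exact he3 m (by omega)
  obtain ⟨N, hN, hN1⟩ := G.exists_straight_pow_eq
  have hall : ∀ m, (G.straight ^ m) d ∈ S := by
    obtain ⟨e, he, -, -, h⟩ := key N
    rw [hN1, Equiv.Perm.one_apply] at he
    subst he
    intro m
    rw [← Nat.mod_add_div m N, pow_add, pow_mul, hN1, one_pow, mul_one]
    exact h _ (Nat.mod_lt _ hN).le
  have hall' : ∀ m, G.rev ((G.straight ^ m) d) ∈ S := fun m =>
    rev_straight_pow_mem hS.region hS.convex (n := m + 1) hd' (fun m _ => hall m) m (by omega)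
  obtain ⟨X, h1, h2, h3, h4, h5, h6⟩ := G.exists_convex_of_strand hc hs d o
  refine hS.not_isConvex hc h1 h2 h3 h4 h5 fun e he he' => ?_
  obtain ⟨m, rfl | rfl⟩ := h6 e he he'
  · exact ⟨hall m, hall' m⟩
  · rw [G.rev_rev]
    exact ⟨hall' m, hall m⟩

/-- Inside a minimal lens strands starting at the boundary have no self-crossings. -/
theorem IsMinimalLens.simple_of_start [Finite D] (hc : G.Connected) (hs : G.Spherical) {o : D}
    {S : Set D} (hS : G.IsMinimalLens o S) {d : D} (hd' : G.rev d ∈ S) (hd2 : G.rot (G.rot d) ∉ S)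
    {n : ℕ} (hn : ∀ m < n, (G.straight ^ m) d ∈ S) (m m' : ℕ) (hm : 1 ≤ m) (hmn : m < n)
    (hm' : 1 ≤ m') (hmn' : m' < n)
    (hv : G.vertexOf ((G.straight ^ m) d) = G.vertexOf ((G.straight ^ m') d)) : m = m' := by
  obtain ⟨i, j, hi, hij, hinj, hclose⟩ := G.exists_first_return d
  have hint := rev_straight_pow_mem hS.region hS.convex hd' hn
  rcases Nat.lt_or_ge j n with hjn | hjn
  · exfalso
    have hbd : ∀ X : Set D, (∀ e ∈ X, G.rev e ∉ X →
        ∃ m, 1 ≤ m ∧ m < j ∧ (e = (G.straight ^ m) d ∨ e = G.rev ((G.straight ^ m) d))) →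
        ∀ e ∈ X, G.rev e ∉ X → e ∈ S ∧ G.rev e ∈ S := by
      intro X hX e he he'
      obtain ⟨m, -, hmj, rfl | rfl⟩ := hX e he he'
      · exact ⟨hn m (by omega), hint m (by omega)⟩
      · rw [G.rev_rev]
        exact ⟨hint m (by omega), hn m (by omega)⟩
    obtain ⟨X, h1, h2, h3, h4, h5, h6⟩ := G.exists_convex_of_return hc hs hi hij hinj hclose
      -- At the initial vertex of `d` the corner `rot (rot (rot d))` is outside `S`, hence outside
      -- `X`. If `d` were in `X`, the edge between these corners would bound `X` without being
      -- interior to `S`.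
      (o := o) (fun X hX hX' ho hdX => by
        have h3 := rot_three_notMem hS.convex (by rwa [hS.region.rev_mem] at hd') hd2
        have hsub := hS.subset_of_boundary hX ho (hbd X hX')
        have h4 := (hbd X hX' (G.rev (G.rot (G.rot (G.rot d))))
          (by rwa [hX.rev_mem, G.rot_four]) (by rw [G.rev_rev]; exact fun h => h3 (hsub h))).2
        rw [G.rev_rev] at h4
        exact h3 h4)
    exact hS.not_isConvex hc h1 h2 h3 h4 h5 (hbd X h6)
  · exact hinj m m' hm (by omega) hm' (by omega) hv

/-- Inside a minimal lens strands have no self-crossings. -/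
theorem IsMinimalLens.simple [Finite D] (hc : G.Connected) (hs : G.Spherical) {o : D}
    {S : Set D} (hS : G.IsMinimalLens o S) {d : D} (hd' : G.rev d ∈ S)
    {n : ℕ} (hn : ∀ m < n, (G.straight ^ m) d ∈ S) (m m' : ℕ) (hm : 1 ≤ m) (hmn : m < n)
    (hm' : 1 ≤ m') (hmn' : m' < n)
    (hv : G.vertexOf ((G.straight ^ m) d) = G.vertexOf ((G.straight ^ m') d)) : m = m' := by
  -- The strand is prolonged backwards to the boundary, which shifts all exponents by `k`.
  obtain ⟨e, k, rfl, he, he', he2, hk⟩ :=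
    hS.exists_start hc hs (hn 0 (by omega)) hd'
  have hpow : ∀ m, (G.straight ^ m) ((G.straight ^ k) e) = (G.straight ^ (m + k)) e := fun m => by
    rw [← Equiv.Perm.mul_apply, ← pow_add]
  simp only [hpow] at hn hv
  have := hS.simple_of_start hc hs he' he2 (n := n + k) (fun t ht => by
    rcases Nat.lt_or_ge k t with h | h
    · obtain ⟨r, rfl⟩ := Nat.exists_eq_add_of_lt h
      have := hn (r + 1) (by omega)
      rwa [show r + 1 + k = k + r + 1 by omega] at this
    · exact hk t h) (m + k) (m' + k) (by omega) (by omega) (by omega) (by omega) hv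
  omega

/-! ### Chords of a disc -/

/-- The first `n` edges of the strand of `d` form an arc that cuts the region `T`. -/
structure IsChord (G : FourValentMap D) (T : Set D) (d : D) (n : ℕ) : Prop where
  mem : d ∈ T
  rot_mem : G.rot d ∈ T
  rot_rot_notMem : G.rot (G.rot d) ∉ T
  pos : 0 < n
  mem_of_lt : ∀ m < n, (G.straight ^ m) d ∈ T
  notMem : (G.straight ^ n) d ∉ T

/-- The strand comes back to `d` by periodicity, and the edge by which it arrives has on its left
the corner `rot (rot (rot d))`, which is outside `T`. So the strand must have left `T`. -/
theorem exists_isChord [Finite D] {T : Set D} (hT : G.IsRegion T) (hconv : G.IsConvex T) {d : D}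
    (h0 : d ∈ T) (h1 : G.rot d ∈ T) (h2 : G.rot (G.rot d) ∉ T) : ∃ n, G.IsChord T d n := by
  classical
  have h3 := rot_three_notMem hconv h1 h2
  have hex : ∃ n, (G.straight ^ n) d ∉ T := by
    obtain ⟨N, hN, hN1⟩ := G.exists_straight_pow_eq
    refine ⟨N - 1, fun h => h3 ?_⟩
    have : d = G.straight ((G.straight ^ (N - 1)) d) := by
      rw [← straight_pow_succ, Nat.sub_add_cancel hN, hN1, Equiv.Perm.one_apply]
    rw [this, hT.rot_straight_mem]
    exact h
  refine ⟨Nat.find hex, h0, h1, h2, ?_, fun m hm => ?_, Nat.find_spec hex⟩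
  · rw [Nat.find_pos]
    simpa using h0
  · exact not_not.1 (Nat.find_min hex hm)

namespace IsChord

variable {T : Set D} {d : D} {n : ℕ}

theorem rev_mem (h : G.IsChord T d n) (hT : G.IsRegion T) (hconv : G.IsConvex T) :
    ∀ m < n, G.rev ((G.straight ^ m) d) ∈ T :=
  rev_straight_pow_mem hT hconv (by rw [hT.rev_mem]; exact h.rot_mem) h.mem_of_lt

/-- The four corners at an inner vertex of the chord lie on the two sides of the arriving and of the
departing edge. -/
theorem vertex_mem (h : G.IsChord T d n) (hT : G.IsRegion T) (hconv : G.IsConvex T) {m : ℕ}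
    (h0 : 0 < m) (hm : m < n) {e : D} (he : G.vertexOf ((G.straight ^ m) d) = G.vertexOf e) :
    e ∈ T := by
  obtain ⟨k, rfl⟩ : ∃ k, m = k + 1 := ⟨m - 1, by omega⟩
  rcases (G.vertexOf_eq_iff _ _).1 he with rfl | rfl | rfl | rfl
  · exact h.mem_of_lt _ hm
  · rw [← hT.rev_mem]; exact h.rev_mem hT hconv _ hm
  · rw [straight_pow_succ, rot_straight]; exact h.rev_mem hT hconv _ (by omega)
  · rw [straight_pow_succ, hT.rot_straight_mem]; exact h.mem_of_lt _ (by omega)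

/-- The last dart of a chord, reversed. -/
theorem exists_end (h : G.IsChord T d n) (hT : G.IsRegion T) (hconv : G.IsConvex T) :
    ∃ g, G.OnPath d n g ∧ G.rot (G.rot g) = (G.straight ^ n) d ∧ g ∈ T ∧ G.rot g ∈ T ∧ g ≠ d := by
  obtain ⟨k, rfl⟩ : ∃ k, n = k + 1 := ⟨n - 1, by have := h.pos; omega⟩
  have h1 := h.rev_mem hT hconv k (by omega)
  refine ⟨G.rev ((G.straight ^ k) d), ⟨k, by omega, Or.inr rfl⟩, ?_, h1, ?_, ?_⟩
  · rw [← straight_apply, straight_pow_succ]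
  · rw [← next_apply, hT]; exact h.mem_of_lt k (by omega)
  · exact fun h => G.straight_pow_ne_rev_pow 0 k d h.symm

/-- Inner vertices have all four corners in `T`, unlike the ends. The two ends differ because at a
boundary vertex of a convex region only one dart has both of its sides inside. -/
theorem vertex_injective (h : G.IsChord T d n) (hT : G.IsRegion T) (hconv : G.IsConvex T)
    (hsimple : ∀ m m', 1 ≤ m → m < n → 1 ≤ m' → m' < n →
      G.vertexOf ((G.straight ^ m) d) = G.vertexOf ((G.straight ^ m') d) → m = m') :
    ∀ m ≤ n, ∀ m' ≤ n,
      G.vertexOf ((G.straight ^ m) d) = G.vertexOf ((G.straight ^ m') d) → m = m' := by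
  have h0 : ∀ m, 0 < m → m < n → G.vertexOf ((G.straight ^ m) d) ≠ G.vertexOf d := by
    intro m h0 hm hv
    exact h.rot_rot_notMem (h.vertex_mem hT hconv h0 hm (by rw [hv, vertexOf_rot, vertexOf_rot]))
  have hn : ∀ m, 0 < m → m < n → G.vertexOf ((G.straight ^ m) d) ≠
      G.vertexOf ((G.straight ^ n) d) := fun m h0 hm hv => h.notMem (h.vertex_mem hT hconv h0 hm hv)
  have h0n : G.vertexOf ((G.straight ^ n) d) ≠ G.vertexOf d := by
    obtain ⟨g, -, hg, hg0, hg1, hgd⟩ := h.exists_end hT hconv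
    rw [← hg, vertexOf_rot, vertexOf_rot, ne_comm, ne_eq, vertexOf_eq_iff]
    have h2 := h.rot_rot_notMem
    have h3 := rot_three_notMem hconv h.rot_mem h2
    rintro (rfl | rfl | rfl | rfl)
    · exact hgd rfl
    · exact h2 hg1
    · exact h2 hg0
    · exact h3 hg0
  intro m hm m' hm' hv
  rcases Nat.eq_zero_or_pos m with rfl | hm0 <;> rcases Nat.eq_zero_or_pos m' with rfl | hm0'
  · rfl
  · rcases hm'.lt_or_eq with h' | rfl
    · exact absurd hv.symm (h0 _ hm0' h')
    · exact absurd hv.symm h0n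
  · rcases hm.lt_or_eq with h' | rfl
    · exact absurd hv (h0 _ hm0 h')
    · exact absurd hv h0n
  · rcases hm.lt_or_eq with h' | rfl <;> rcases hm'.lt_or_eq with h'' | rfl
    · exact hsimple m m' hm0 h' hm0' h'' hv
    · exact absurd hv (hn _ hm0 h')
    · exact absurd hv.symm (hn _ hm0' h'')
    · rfl

end IsChord

theorem OnPath.exists_vertex {d e : D} {n : ℕ} (h : G.OnPath d n e) :
    ∃ m ≤ n, e = (G.straight ^ m) d ∨ e = G.rot (G.rot ((G.straight ^ m) d)) := by
  obtain ⟨m, hm, h | h⟩ := h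
  · exact ⟨m, hm.le, Or.inl h⟩
  · exact ⟨m + 1, hm, Or.inr (by rw [h, straight_pow_succ, rot_straight])⟩

/-- Two darts of a simple arc at the same vertex are equal or opposite. -/
theorem OnPath.eq_or_eq {d e e' : D} {n : ℕ}
    (hinj : ∀ m ≤ n, ∀ m' ≤ n,
      G.vertexOf ((G.straight ^ m) d) = G.vertexOf ((G.straight ^ m') d) → m = m')
    (h : G.OnPath d n e) (h' : G.OnPath d n e') (hv : G.vertexOf e = G.vertexOf e') :
    e' = e ∨ e' = G.rot (G.rot e) := by
  obtain ⟨m, hm, h⟩ := h.exists_vertex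
  obtain ⟨m', hm', h'⟩ := h'.exists_vertex
  have : m = m' := by
    apply hinj m hm m' hm'
    rcases h with rfl | rfl <;> rcases h' with rfl | rfl <;> simpa only [vertexOf_rot] using hv
  subst this
  rcases h with rfl | rfl <;> rcases h' with rfl | rfl <;> simp [G.rot_four]

theorem OnPath.not_rot {d e : D} {n : ℕ}
    (hinj : ∀ m ≤ n, ∀ m' ≤ n,
      G.vertexOf ((G.straight ^ m) d) = G.vertexOf ((G.straight ^ m') d) → m = m')
    (h : G.OnPath d n e) : ¬ G.OnPath d n (G.rot e) := fun h' => by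
  rcases OnPath.eq_or_eq hinj h h' (G.vertexOf_rot e).symm with h1 | h1
  · exact G.rot_ne e h1
  · exact G.rot_ne _ h1.symm

/-- A chord of a disc separates it. -/
theorem IsChord.exists_separation [Finite D] (hc : G.Connected) (hs : G.Spherical) {o : D}
    {T : Set D} (hT : G.IsDisc o T) {d : D} {n : ℕ} (h : G.IsChord T d n)
    (hinj : ∀ m ≤ n, ∀ m' ≤ n,
      G.vertexOf ((G.straight ^ m) d) = G.vertexOf ((G.straight ^ m') d) → m = m') :
    ∃ X, G.IsRegion X ∧ ∀ e ∈ T, G.rev e ∈ T → (G.OnPath d n e ↔ ¬ (e ∈ X ↔ G.rev e ∈ X)) := by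
  set x := G.rot (G.rot d) with hx
  have hvc : ∀ {a b : D}, G.vertexOf a = G.vertexOf b → G.vertexChain a = G.vertexChain b := by
    intro a b hab
    funext e
    rw [vertexChain, hab, vertexChain]
  -- `R e`: the initial vertex of `e` is joined to that of `x` by a chain of edges none of which is
  -- interior to `T`.
  let R : D → Prop := fun e => ∃ z : D → ZMod 2, (∀ a, z (G.rev a) = z a) ∧
    (∀ a ∈ T, G.rev a ∈ T → z a = 0) ∧
    ∀ a, G.boundary z a = G.vertexChain x a + G.vertexChain e a
  have hRrev : ∀ e, (e ∉ T ∨ G.rev e ∉ T) → R e → R (G.rev e) := by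
    rintro e he ⟨z, hz1, hz2, hz3⟩
    refine ⟨fun a => z a + G.edgeChain e a, fun a => ?_, fun a ha ha' => ?_, fun a => ?_⟩
    · simp only [hz1, edgeChain_rev]
    · simp only [hz2 a ha ha', zero_add]
      refine if_neg ?_
      rintro (rfl | rfl)
      · tauto
      · rw [G.rev_rev] at ha'; tauto
    · rw [boundary_add, hz3, boundary_edgeChain]
      have : ∀ a b c : ZMod 2, a + b + (b + c) = a + c := by decide
      exact this _ _ _
  have hRv : ∀ {a b : D}, G.vertexOf a = G.vertexOf b → R a → R b := by
    rintro a b hab ⟨z, hz1, hz2, hz3⟩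
    exact ⟨z, hz1, hz2, by rwa [← hvc hab]⟩
  have hvn : ∀ e, G.vertexOf (G.next e) = G.vertexOf (G.rev e) := fun e => by
    rw [next_apply, vertexOf_rot]
  have hY : G.IsRegion {e | e ∉ T ∧ R e} := by
    intro e
    simp only [Set.mem_ofPred_eq, hT.region e]
    refine and_congr_right fun he => ⟨fun hR => ?_, fun hR => ?_⟩
    · have := hRrev (G.rev e) (Or.inr (by rwa [G.rev_rev])) (hRv (hvn e) hR)
      rwa [G.rev_rev] at this
    · exact hRv (hvn e).symm (hRrev e (Or.inl he) hR)
  -- Since the complement of `T` is connected, the two ends of the chord are joined outside. Chord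
  -- and outer chain together form a cycle, and the region it bounds separates `T` exactly along the
  -- chord.
  have hRn : R ((G.straight ^ n) d) := by
    have := hT.coconnected _ hY (fun e he he1 he2 => ⟨he2, hRrev e (Or.inl he1) he.2⟩) x
      ⟨h.rot_rot_notMem, fun _ => 0, fun _ => rfl, fun _ _ _ => rfl, fun a => by
        simp [boundary, zmod_two_add_self]⟩ h.rot_rot_notMem _ h.notMem
    exact this.2
  obtain ⟨z, hz1, hz2, hz3⟩ := hRn
  obtain ⟨X, hX, -, hXz⟩ := G.exists_region_of_cycle hc hs (fun a => G.pathChain d n a + z a)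
    (fun a => by simp only [pathChain_rev, hz1]) (fun a => by
      rw [boundary_add, boundary_pathChain, hz3,
        hvc (show G.vertexOf x = G.vertexOf d by rw [hx, vertexOf_rot, vertexOf_rot])]
      exact zmod_two_add_self _) o
  refine ⟨X, hX, fun e he he' => ?_⟩
  rw [← hXz, hz2 e he he', add_zero, pathChain_eq]
  · split_ifs with h <;> simp [h]
  · intro m hm m' hm' h
    exact hinj m hm.le m' hm'.le (by rw [h])

end FourValentMap

/-! ### Cutting a disc along a chord -/

namespace FourValentMap

variable {D : Type*} {G : FourValentMap D}

/-- The corners of the piece `T ∩ X` of a disc `T` cut along a chord are the corners of `T` in `X`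
and two new ones. -/
theorem IsChord.ncard_corners_inter [Finite D] {T X : Set D} {d : D} {n : ℕ}
    (h : G.IsChord T d n) (hT : G.IsRegion T) (hconv : G.IsConvex T) (hX : G.IsRegion X)
    (hinj : ∀ m ≤ n, ∀ m' ≤ n,
      G.vertexOf ((G.straight ^ m) d) = G.vertexOf ((G.straight ^ m') d) → m = m')
    (hsep : ∀ e ∈ T, G.rev e ∈ T → (G.OnPath d n e ↔ ¬ (e ∈ X ↔ G.rev e ∈ X))) :
    G.IsConvex (T ∩ X) ∧ G.corners T ∩ X ⊆ G.corners (T ∩ X) ∧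
      (d ∈ X → d ∈ G.corners (T ∩ X)) ∧ (G.rot d ∈ X → G.rot d ∈ G.corners (T ∩ X)) ∧
      (d ∈ X ↔ G.rot d ∉ X) ∧
      (G.corners (T ∩ X)).ncard = (G.corners T ∩ X).ncard + 2 := by
  have hrot : ∀ e ∈ T, G.rot e ∈ T → (G.OnPath d n e ↔ (e ∈ X ↔ G.rot e ∉ X)) := by
    intro e he he'
    rw [← hX.rev_mem]
    refine Iff.trans ?_ (not_iff.trans (Iff.comm.trans iff_not_comm))
    exact hsep e he ((hT.rev_mem e).2 he')
  have hnot : ∀ e, G.OnPath d n e → ¬ G.OnPath d n (G.rot e) := fun e he => he.not_rot hinj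
  obtain ⟨g, hgP, hg2, hg0, hg1, hgd⟩ := h.exists_end hT hconv
  have hg2' : G.rot (G.rot g) ∉ T := hg2 ▸ h.notMem
  have hg3 := rot_three_notMem hconv hg1 hg2'
  have hd3 := rot_three_notMem hconv h.rot_mem h.rot_rot_notMem
  have hdP : G.OnPath d n d := ⟨0, h.pos, Or.inl rfl⟩
  have hsplit : ∀ e, G.OnPath d n e → e ∈ T → G.rot e ∈ T → G.rot (G.rot e) ∉ T →
      (e ∈ X ↔ G.rot e ∉ X) ∧ (e ∈ X → e ∈ G.corners (T ∩ X)) ∧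
      (G.rot e ∈ X → G.rot e ∈ G.corners (T ∩ X)) := by
    intro e heP h0 h1 h2
    have h3 := rot_three_notMem hconv h1 h2
    have h4 := (hrot e h0 h1).1 heP
    refine ⟨h4, fun hx => ⟨⟨h0, hx⟩, fun h => h4.1 hx h.2, fun h => h3 h.1⟩,
      fun hx => ⟨⟨h1, hx⟩, fun h => h2 h.1, fun h => ?_⟩⟩
    rw [G.rot_four] at h
    exact h4.1 h.2 hx
  obtain ⟨hd_iff, hdc, hdc'⟩ := hsplit d hdP h.mem h.rot_mem h.rot_rot_notMem
  obtain ⟨hg_iff, hgc, hgc'⟩ := hsplit g hgP hg0 hg1 hg2'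
  have hold : G.corners T ∩ X ⊆ G.corners (T ∩ X) := fun e ⟨⟨h1, h2, h3⟩, h4⟩ =>
    ⟨⟨h1, h4⟩, fun h => h2 h.1, fun h => h3 h.1⟩
  -- A chord through a vertex on the boundary of the disc ends there.
  have hends : ∀ e, G.OnPath d n e → e ∈ T → G.rot e ∈ T →
      G.rot (G.rot e) ∉ T → e = d ∨ e = g := by
    intro e heP h0 h1 h2
    obtain ⟨m, hm, he⟩ := heP.exists_vertex
    have hv : G.vertexOf ((G.straight ^ m) d) = G.vertexOf e := by
      rcases he with rfl | rfl <;> simp only [vertexOf_rot]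
    have huniq : ∀ x, G.rot (G.rot x) ∉ T → G.rot x ∈ T → x ∈ T → G.vertexOf x = G.vertexOf e →
        e = x := by
      intro x hx2 hx1 hx0 hv
      have h3 := rot_three_notMem hconv h1 h2
      rcases (G.vertexOf_eq_iff _ _).1 hv with rfl | rfl | rfl | rfl
      · rfl
      · exact absurd h1 hx2
      · exact absurd h0 hx2
      · exact absurd h0 (rot_three_notMem hconv hx1 hx2)
    rcases Nat.eq_zero_or_pos m with rfl | h0m
    · exact Or.inl (huniq d h.rot_rot_notMem h.rot_mem h.mem hv)
    · rcases hm.lt_or_eq with hm | rfl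
      · exact absurd (h.vertex_mem hT hconv h0m hm (hv.trans (by simp only [vertexOf_rot]))) h2
      · exact Or.inr (huniq g hg2' hg1 hg0
          (by rw [← hv, ← hg2, vertexOf_rot, vertexOf_rot]))
  have hnew : ∀ e ∈ G.corners (T ∩ X), e ∉ G.corners T →
      e = d ∨ e = G.rot d ∨ e = g ∨ e = G.rot g := by
    rintro e ⟨⟨h0, hx⟩, h1, h3⟩ hne
    have hT1 : G.rot e ∈ T → G.OnPath d n e := fun ht => by
      rw [hrot e h0 ht]
      exact ⟨fun _ h => h1 ⟨ht, h⟩, fun _ => hx⟩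
    have hT3 : G.rot (G.rot (G.rot e)) ∈ T → G.OnPath d n (G.rot (G.rot (G.rot e))) := fun ht => by
      rw [hrot _ ht (by rwa [G.rot_four]), G.rot_four]
      exact ⟨fun h => absurd ⟨ht, h⟩ h3, fun h => absurd hx h⟩
    by_cases ht1 : G.rot e ∈ T
    · have ht3 : G.rot (G.rot (G.rot e)) ∉ T := fun ht3 =>
        hnot _ (hT3 ht3) (by rw [G.rot_four]; exact hT1 ht1)
      have ht2 : G.rot (G.rot e) ∉ T := fun ht2 => ht3 (hconv _ ht2 (by rwa [G.rot_four]))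
      rcases hends e (hT1 ht1) h0 ht1 ht2 with h | h
      · exact Or.inl h
      · exact Or.inr (Or.inr (Or.inl h))
    · by_cases ht3 : G.rot (G.rot (G.rot e)) ∈ T
      · have := hends _ (hT3 ht3) ht3 (by rwa [G.rot_four]) (by rwa [G.rot_four])
        rcases this with h | h <;> rw [← h, G.rot_four]
        · exact Or.inr (Or.inl rfl)
        · exact Or.inr (Or.inr (Or.inr rfl))
      · exact absurd ⟨h0, ht1, ht3⟩ hne
  refine ⟨?_, hold, hdc, hdc', hd_iff, ?_⟩
  · rintro e ⟨he, hxe⟩ ⟨he2, hxe2⟩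
    have he1 := hconv e he he2
    refine ⟨he1, ?_⟩
    by_contra hx1
    have h1 := (hrot e he he1).2 ⟨fun _ => hx1, fun _ => hxe⟩
    have h2 := (hrot _ he1 he2).2 ⟨fun h => absurd h hx1, fun h => absurd hxe2 h⟩
    exact hnot _ h1 h2
  -- At each end the chord separates two corners, exactly one of which lies in `X`: `a` at the start
  -- and `b` at the end.
  · obtain ⟨a, ha, ha'⟩ : ∃ a, (a = d ∨ a = G.rot d) ∧ (a ∈ G.corners (T ∩ X)) := by
      by_cases hd : d ∈ X
      · exact ⟨d, Or.inl rfl, hdc hd⟩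
      · exact ⟨G.rot d, Or.inr rfl, hdc' (not_not.1 fun h => hd (hd_iff.2 h))⟩
    obtain ⟨b, hb, hb'⟩ : ∃ b, (b = g ∨ b = G.rot g) ∧ (b ∈ G.corners (T ∩ X)) := by
      by_cases hg : g ∈ X
      · exact ⟨g, Or.inl rfl, hgc hg⟩
      · exact ⟨G.rot g, Or.inr rfl, hgc' (not_not.1 fun h => hg (hg_iff.2 h))⟩
    have hncd : ∀ a, a = d ∨ a = G.rot d → a ∉ G.corners T := by
      rintro a (rfl | rfl) ⟨-, h2, h3⟩
      · exact h2 h.rot_mem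
      · rw [G.rot_four] at h3; exact h3 h.mem
    have hncg : ∀ a, a = g ∨ a = G.rot g → a ∉ G.corners T := by
      rintro a (rfl | rfl) ⟨-, h2, h3⟩
      · exact h2 hg1
      · rw [G.rot_four] at h3; exact h3 hg0
    have hab : a ≠ b := by
      rintro rfl
      rcases ha with rfl | rfl <;> rcases hb with hb | hb
      · exact hgd hb.symm
      · exact h.rot_rot_notMem (by rw [hb] at hd3 ⊢; rw [G.rot_four] at hd3; exact absurd hg0 hd3)
      · exact h.rot_rot_notMem (by rw [hb]; exact hg1)
      · exact hgd (G.rot.injective hb.symm)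
    have heq : G.corners (T ∩ X) = insert a (insert b (G.corners T ∩ X)) := by
      apply Set.Subset.antisymm
      · intro e he
        by_cases hne : e ∈ G.corners T
        · exact Or.inr (Or.inr ⟨hne, he.1.2⟩)
        · have hside : ∀ x y z, (y = x ∨ y = G.rot x) → (x ∈ X ↔ G.rot x ∉ X) → y ∈ X → z ∈ X →
              (z = x ∨ z = G.rot x) → z = y := by
            rintro x y z (rfl | rfl) hx hy hz (rfl | rfl)
            · rfl
            · exact absurd hz (hx.1 hy)
            · exact absurd hy (hx.1 hz)
            · rfl
          rcases hnew e he hne with h | h | h | h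
          · exact Or.inl (hside d a e ha hd_iff ha'.1.2 he.1.2 (Or.inl h))
          · exact Or.inl (hside d a e ha hd_iff ha'.1.2 he.1.2 (Or.inr h))
          · exact Or.inr (Or.inl (hside g b e hb hg_iff hb'.1.2 he.1.2 (Or.inl h)))
          · exact Or.inr (Or.inl (hside g b e hb hg_iff hb'.1.2 he.1.2 (Or.inr h)))
      · rintro e (rfl | rfl | he)
        · exact ha'
        · exact hb'
        · exact hold he
    rw [heq, Set.ncard_insert_of_notMem, Set.ncard_insert_of_notMem]
    · exact fun h => hncg b hb h.1
    · rintro (h | h)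
      · exact hab h
      · exact hncd a ha h.1

/-- Cutting a disc in a minimal lens along the chord starting with `d`: the piece containing a
given dart. -/
theorem IsMinimalLens.exists_piece [Finite D] (hc : G.Connected) (hs : G.Spherical) {o : D}
    {S T : Set D} (hS : G.IsMinimalLens o S) (hT : G.IsDisc o T) (hTS : T ⊆ S) {d x : D}
    (h0 : d ∈ T) (h1 : G.rot d ∈ T) (h2 : G.rot (G.rot d) ∉ T) (hx : x ∈ T) :
    ∃ P, G.IsRegion P ∧ P ⊆ T ∧ x ∈ P ∧ G.IsConvex P ∧ G.corners T ∩ P ⊆ G.corners P ∧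
      (d ∈ P → d ∈ G.corners P) ∧ (G.rot d ∈ P → G.rot d ∈ G.corners P) ∧
      (d ∈ G.corners P ∨ G.rot d ∈ G.corners P) ∧
      (G.corners P).ncard = (G.corners T ∩ P).ncard + 2 ∧
      3 ≤ (G.corners (G.fill o P)).ncard ∧ (G.corners T \ P).Nonempty := by
  obtain ⟨n, h⟩ := exists_isChord hT.region hT.convex h0 h1 h2
  have hinj := h.vertex_injective hT.region hT.convex
    (hS.simple hc hs (by rw [hS.region.rev_mem]; exact hTS h1) fun m hm => hTS (h.mem_of_lt m hm))
  obtain ⟨X₀, hX₀, hsep₀⟩ := h.exists_separation hc hs hT hinj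
  obtain ⟨X, hX, hxX, hsep⟩ : ∃ X, G.IsRegion X ∧ x ∈ X ∧
      ∀ e ∈ T, G.rev e ∈ T → (G.OnPath d n e ↔ ¬ (e ∈ X ↔ G.rev e ∈ X)) := by
    by_cases hx0 : x ∈ X₀
    · exact ⟨X₀, hX₀, hx0, hsep₀⟩
    · refine ⟨X₀ᶜ, hX₀.compl, hx0, fun e he he' => (hsep₀ e he he').trans ?_⟩
      rw [Set.mem_compl_iff, Set.mem_compl_iff, not_iff_not, not_iff_not]
  have hsep' : ∀ e ∈ T, G.rev e ∈ T → (G.OnPath d n e ↔ ¬ (e ∈ Xᶜ ↔ G.rev e ∈ Xᶜ)) := by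
    intro e he he'
    rw [hsep e he he', Set.mem_compl_iff, Set.mem_compl_iff, not_iff_not, not_iff_not]
  -- At the start of the chord the boundary of `T` has one edge on each side, so either piece misses
  -- one of them. This is the exception allowed for in `three_le`.
  have hbdry : ∀ Y : Set D, G.IsRegion Y → (d ∈ Y ↔ G.rot d ∉ Y) →
      ∃ b ∈ T, G.rev b ∉ T ∧ b ∉ T ∩ Y := by
    intro Y hY hd
    have h3 := rot_three_notMem hT.convex h1 h2
    by_cases hdY : d ∈ Y
    · exact ⟨G.rot d, h1, by rwa [hT.region.rev_mem], fun h => hd.1 hdY h.2⟩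
    · refine ⟨G.rev (G.rot (G.rot (G.rot d))), ?_, by rwa [G.rev_rev], fun h => hdY ?_⟩
      · rwa [hT.region.rev_mem, G.rot_four]
      · have := h.2
        rwa [hY.rev_mem, G.rot_four] at this
  have hthree : ∀ Y, G.IsRegion Y → G.IsConvex (T ∩ Y) → (T ∩ Y).Nonempty →
      (d ∈ Y ↔ G.rot d ∉ Y) → 3 ≤ (G.corners (G.fill o (T ∩ Y))).ncard := by
    intro Y hY hconv hne hd
    obtain ⟨b, hb, hb', hb''⟩ := hbdry Y hY hd
    exact hS.three_le hT hTS Set.inter_subset_left (hT.region.inter hY) hconv hne hb hb' hb''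
  obtain ⟨a1, a2, a3, a4, a5, a6⟩ := h.ncard_corners_inter hT.region hT.convex hX hinj hsep
  obtain ⟨b1, b2, b3, b4, b5, b6⟩ := h.ncard_corners_inter hT.region hT.convex hX.compl hinj hsep'
  have hcap : G.corners T ∩ (T ∩ X) = G.corners T ∩ X := by
    ext e
    exact ⟨fun h => ⟨h.1, h.2.2⟩, fun h => ⟨h.1, h.1.1, h.2⟩⟩
  refine ⟨T ∩ X, hT.region.inter hX, Set.inter_subset_left, ⟨hx, hxX⟩, a1, ?_,
    fun h => a3 h.2, fun h => a4 h.2, ?_, ?_, hthree X hX a1 ⟨x, hx, hxX⟩ a5, ?_⟩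
  · rwa [hcap]
  · by_cases hd : d ∈ X
    · exact Or.inl (a3 hd)
    · exact Or.inr (a4 (by tauto))
  · rw [hcap, a6]
  -- The other piece also has at least three corners, of which only two are new; the remaining one
  -- is a corner of `T` outside `P`.
  · have hne : (T ∩ Xᶜ).Nonempty := by
      by_cases hd : d ∈ X
      · exact ⟨G.rot d, h1, a5.1 hd⟩
      · exact ⟨d, h0, hd⟩
    have h3 := hthree Xᶜ hX.compl b1 hne b5
    have h4 := ncard_corners_fill_le (hT.region.inter hX.compl) (fun h => hT.notMem h.1) (o := o)
    have h5 : (G.corners T ∩ Xᶜ).Nonempty := by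
      rw [← Set.ncard_pos]; omega
    obtain ⟨e, he, he'⟩ := h5
    exact ⟨e, he, fun h => he' h.2⟩

/-- Cutting a disc in a minimal lens along a chord so that one old corner remains in the piece
gives a smaller triangular disc. -/
theorem IsMinimalLens.exists_triangle_disc [Finite D] (hc : G.Connected) (hs : G.Spherical)
    {o : D} {S T : Set D} (hS : G.IsMinimalLens o S) (hT : G.IsDisc o T) (hTS : T ⊆ S) {d h : D}
    (h0 : d ∈ T) (h1 : G.rot d ∈ T) (h2 : G.rot (G.rot d) ∉ T) (hh : h ∈ G.corners T)
    (hcard : ∀ P, G.IsRegion P → h ∈ P → (G.corners T \ P).Nonempty →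
      (G.corners T ∩ P).ncard ≤ 1) :
    ∃ F, G.IsDisc o F ∧ F ⊆ T ∧ F.ncard < T.ncard ∧ (G.corners F).ncard = 3 ∧
      h ∈ G.corners F ∧ (G.next h = d → d ∈ G.corners F) ∧
      (G.next (G.rot d) = h → G.rot d ∈ G.corners F) := by
  obtain ⟨P, p1, p2, p3, p4, p5, p6, p7, p8, p9, p10, p11⟩ :=
    hS.exists_piece hc hs hT hTS h0 h1 h2 hh.1
  have ho : o ∉ P := fun h => hT.notMem (p2 h)
  have h3 := corners_fill_subset p1 ho
  -- The piece has at most one old and exactly two new corners, and its filling has at least three,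
  -- so filling loses none.
  have h4 := hcard P p1 p3 p11
  have heq : G.corners (G.fill o P) = G.corners P :=
    Set.eq_of_subset_of_ncard_le h3 (by omega)
  have h5 := Set.ncard_le_ncard h3
  have hfT := fill_subset hT p2
  refine ⟨G.fill o P, isDisc_fill p1 p4 ⟨_, p3⟩ ho, hfT, ?_, by omega, ?_, ?_, ?_⟩
  · refine Set.ncard_lt_ncard (hfT.ssubset_of_ne fun hF => ?_)
    rw [hF] at heq
    rw [← heq] at p8
    rcases p8 with ⟨-, h, -⟩ | ⟨-, -, h⟩
    · exact h h1
    · rw [G.rot_four] at h; exact h h0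
  · rw [heq]; exact p5 ⟨hh, p3⟩
  · rw [heq]
    rintro rfl
    exact p6 ((p1 _).2 p3)
  · rw [heq]
    rintro rfl
    exact p7 ((p1 _).1 p3)

/-! ### Sides of a disc -/

section sides

variable {S T : Set D}

theorem straight_of_next_notMem_corners (hT : G.IsRegion T) (hconv : G.IsConvex T) {e : D}
    (he : e ∈ T) (he' : G.rev e ∉ T) (hn : G.next e ∉ G.corners T) :
    G.next e ∈ T ∧ G.straight e ∈ T ∧ G.rev (G.straight e) ∉ T ∧
      G.straight e ∉ G.corners T := by
  have h0 : G.next e ∈ T := (hT e).2 he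
  have h3 : G.rot (G.rot (G.rot (G.next e))) ∉ T := by rwa [next_apply, G.rot_four]
  have h1 : G.straight e ∈ T := by
    by_contra h
    exact hn ⟨h0, h, h3⟩
  refine ⟨h0, h1, ?_, fun h => h.2.2 ?_⟩
  · rw [hT.rev_mem]
    intro h2
    exact h3 (hconv _ h2 (by rwa [G.rot_four]))
  · rwa [hT.rot_straight_mem]

/-- This keeps a whole side of a smaller disc `T ⊆ S` on the boundary of `S` once one of its edges
is there. -/
theorem rev_straight_notMem (hS : G.IsRegion S) (hconv : G.IsConvex S) {e : D} (he : e ∈ S)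
    (he' : G.rev e ∉ S) : G.rev (G.straight e) ∉ S := by
  rw [hS.rev_mem]
  intro h2
  have h0 : G.next e ∈ S := (hS e).2 he
  have := hconv _ h2 (by rwa [straight_apply, G.rot_four, ← next_apply])
  rw [rot_straight] at this
  exact he' this

/-- Running along a side of a region from one corner to the next. -/
theorem exists_side_end [Finite D] (hT : G.IsRegion T) (hconvT : G.IsConvex T)
    (hS : G.IsRegion S) (hconvS : G.IsConvex S) (hTS : T ⊆ S) {e : D} (he : e ∈ G.corners T) :
    ∃ y ∈ T, G.rev y ∉ T ∧ G.next y ∈ G.corners T ∧ (G.rev e ∉ S → G.rev y ∉ S) ∧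
      (y = e ∨ y ∉ G.corners T) := by
  by_contra hcon
  have key : ∀ n, (G.straight ^ n) e ∈ T ∧ G.rev ((G.straight ^ n) e) ∉ T ∧
      (G.rev e ∉ S → G.rev ((G.straight ^ n) e) ∉ S) ∧
      (n = 0 ∨ (G.straight ^ n) e ∉ G.corners T) := by
    intro n
    induction n with
    | zero => exact ⟨he.1, by rw [hT.rev_mem]; exact he.2.1, fun h => h, Or.inl rfl⟩
    | succ n ih =>
      obtain ⟨h1, h2, h3, h4⟩ := ih
      have hn : G.next ((G.straight ^ n) e) ∉ G.corners T := by
        intro hn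
        refine hcon ⟨_, h1, h2, hn, h3, ?_⟩
        rcases h4 with rfl | h4
        · exact Or.inl rfl
        · exact Or.inr h4
      obtain ⟨-, h5, h6, h7⟩ := straight_of_next_notMem_corners hT hconvT h1 h2 hn
      rw [straight_pow_succ]
      exact ⟨h5, h6, fun h => rev_straight_notMem hS hconvS (hTS h1) (h3 h), Or.inr h7⟩
  -- A side without an end would return after a period to `e`, which is a corner.
  obtain ⟨N, hN, hN1⟩ := G.exists_straight_pow_eq
  obtain ⟨-, -, -, h | h⟩ := key N
  · omega
  · rw [hN1] at h
    exact h he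

/-- Running backwards along a side of a region from one corner to the previous one. -/
theorem exists_side_start [Finite D] (hT : G.IsRegion T) (hconvT : G.IsConvex T)
    (hS : G.IsRegion S) (hconvS : G.IsConvex S) (hTS : T ⊆ S) {p : D}
    (hp : G.next p ∈ G.corners T) :
    ∃ h ∈ G.corners T, (G.rev p ∉ S → G.rev h ∉ S) ∧ (h = p ∨ G.straight h ∈ T) := by
  by_contra hcon
  have hpT : p ∈ T := (hT p).1 hp.1
  have hrp : G.rev p ∉ T := by
    have := hp.2.2
    rwa [next_apply, G.rot_four] at this
  have key : ∀ n, ∃ y ∈ T, G.rev y ∉ T ∧ (G.rev p ∉ S → G.rev y ∉ S) ∧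
      (y = p ∨ G.straight y ∈ T) ∧ (G.straight ^ n) y = p := by
    intro n
    induction n with
    | zero => exact ⟨p, hpT, hrp, fun h => h, Or.inl rfl, rfl⟩
    | succ n ih =>
      obtain ⟨y, h1, h2, h3, h4, h5⟩ := ih
      have h6 : G.rot y ∉ T := by rwa [← hT.rev_mem]
      have h7 : G.rot (G.rot (G.rot y)) ∈ T := by
        by_contra h
        exact hcon ⟨y, ⟨h1, h6, h⟩, h3, h4⟩
      obtain ⟨x, rfl⟩ := G.straight.surjective y
      refine ⟨x, ?_, ?_, fun h => ?_, Or.inr h1, ?_⟩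
      · rwa [hT.rot_straight_mem] at h7
      · rw [← rot_straight]
        exact fun h => h6 (hconvT _ h1 h)
      · have h8 := h3 h
        rw [hS.rev_mem] at h8
        rw [← rot_straight]
        exact fun h => h8 (hconvS _ (hTS h1) h)
      · rw [pow_succ, Equiv.Perm.mul_apply, h5]
  obtain ⟨N, hN, hN1⟩ := G.exists_straight_pow_eq
  obtain ⟨y, hy, -, -, -, hyp⟩ := key (N - 1)
  have : y = G.straight p := by
    rw [← hyp, ← straight_pow_succ, Nat.sub_add_cancel hN, hN1, Equiv.Perm.one_apply]
  rw [this] at hy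
  exact hp.2.1 hy

/-- A chord starts next to the end of a boundary dart that is not followed by a corner. -/
theorem chord_of_next_notMem_corners (hT : G.IsRegion T) (hconv : G.IsConvex T) {e : D}
    (he : e ∈ T) (he' : G.rev e ∉ T) (hn : G.next e ∉ G.corners T) :
    G.next e ∈ T ∧ G.rot (G.next e) ∈ T ∧ G.rot (G.rot (G.next e)) ∉ T := by
  obtain ⟨h0, h1, h2, -⟩ := straight_of_next_notMem_corners hT hconv he he' hn
  exact ⟨h0, h1, by rwa [hT.rev_mem] at h2⟩

/-- A chord starts at the beginning of a boundary dart that is not a corner. -/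
theorem chord_of_notMem_corners (hT : G.IsRegion T) {i : D} (hi : i ∈ T) (hi' : G.rev i ∉ T)
    (hn : i ∉ G.corners T) : G.rot (G.rot (G.rot i)) ∈ T ∧
      G.rot (G.rot (G.rot (G.rot i))) ∈ T ∧ G.rot (G.rot (G.rot (G.rot (G.rot i)))) ∉ T := by
  rw [hT.rev_mem] at hi'
  rw [G.rot_four]
  exact ⟨by_contra fun h => hn ⟨hi, hi', h⟩, hi, hi'⟩

end sides

theorem eq_of_ncard_eq_three {α : Type*} [Finite α] {A : Set α} (hA : A.ncard = 3) {a b c : α}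
    (ha : a ∈ A) (hb : b ∈ A) (hc : c ∈ A) (hab : a ≠ b) (hac : a ≠ c) (hbc : b ≠ c) :
    A = {a, b, c} := by
  refine (Set.eq_of_subset_of_ncard_le ?_ ?_).symm
  · rintro x (rfl | rfl | rfl) <;> assumption
  · rw [hA, Set.ncard_eq_three.2 ⟨a, b, c, hab, hac, hbc, rfl⟩]

end FourValentMap

/-! ### From triangular discs to a triangular face -/

namespace FourValentMap

variable {D : Type*} {G : FourValentMap D}

theorem vertexOf_ne_of_corners {T : Set D} (hconv : G.IsConvex T) {a b : D} (ha : a ∈ G.corners T)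
    (hb : b ∈ G.corners T) (hab : a ≠ b) : G.vertexOf a ≠ G.vertexOf b := by
  rw [ne_eq, vertexOf_eq_iff]
  rintro (rfl | rfl | rfl | rfl)
  · exact hab rfl
  · exact ha.2.1 hb.1
  · exact ha.2.1 (hconv _ ha.1 hb.1)
  · exact ha.2.2 hb.1

theorem rev_notMem_of_corners {T : Set D} (hT : G.IsRegion T) {a : D} (ha : a ∈ G.corners T) :
    G.rev a ∉ T := by
  rw [hT.rev_mem]; exact ha.2.1

/-- If all corners of a disc lie on one face, then no chord starts at the end of a side. -/
theorem IsMinimalLens.next_mem_corners [Finite D] (hc : G.Connected) (hs : G.Spherical) {o : D}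
    {S T : Set D} (hS : G.IsMinimalLens o S) (hT : G.IsDisc o T) (hTS : T ⊆ S) {e : D}
    (he : e ∈ G.corners T) (hP : ∀ P, G.IsRegion P → e ∈ P → G.corners T ⊆ P) :
    G.next e ∈ G.corners T := by
  by_contra hn
  obtain ⟨h0, h1, h2⟩ := chord_of_next_notMem_corners hT.region hT.convex he.1
    (rev_notMem_of_corners hT.region he) hn
  obtain ⟨P, p1, -, p3, -, -, -, -, -, -, -, x, hx, hx'⟩ :=
    hS.exists_piece hc hs hT hTS h0 h1 h2 he.1
  exact hx' (hP P p1 p3 hx)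

/-- `f` and `next f` border the same face, so a region contains both or neither. If it contains `h`
but not all three, it contains neither. -/
theorem ncard_inter_le_one [Finite D] {A P : Set D} (hP : G.IsRegion P) {f h : D}
    (hA : A = {f, G.next f, h}) (hh : h ∈ P) (hne : (A \ P).Nonempty) : (A ∩ P).ncard ≤ 1 := by
  subst hA
  have hf : f ∉ P := by
    intro hf
    obtain ⟨x, rfl | rfl | rfl, hx'⟩ := hne
    · exact hx' hf
    · exact hx' ((hP _).2 hf)
    · exact hx' hh
  rw [Set.ncard_le_one]
  have key : ∀ x ∈ ({f, G.next f, h} : Set D) ∩ P, x = h := by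
    rintro x ⟨rfl | rfl | rfl, hx'⟩
    · exact absurd hx' hf
    · exact absurd ((hP _).1 hx') hf
    · rfl
  intro a ha b hb
  rw [key a ha, key b hb]

/-- A triangular disc in a minimal lens, one of whose sides is an edge and exactly one of whose
other sides lies on the boundary of the lens, gives rise to a triangular face at this boundary. -/
theorem IsMinimalLens.exists_triangle_of_disc [Finite D] (hc : G.Connected) (hs : G.Spherical)
    {o : D} {S : Set D} (hS : G.IsMinimalLens o S) (hloop : ∀ d ∈ S, G.next d ≠ d) (n : ℕ) :
    ∀ (T : Set D) (f p : D), T.ncard = n → G.IsDisc o T → T ⊆ S → (G.corners T).ncard = 3 →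
      f ∈ G.corners T → G.next f ∈ G.corners T → G.next p = f →
      ((G.rev p ∉ S ∧ G.rev (G.next f) ∈ S) ∨ (G.rev p ∈ S ∧ G.rev (G.next f) ∉ S)) →
      ∃ t ∈ S, G.rev t ∉ S ∧ G.next (G.next (G.next t)) = t ∧
        G.vertexOf t ≠ G.vertexOf (G.next t) ∧
        G.vertexOf (G.next t) ≠ G.vertexOf (G.next (G.next t)) ∧
        G.vertexOf (G.next (G.next t)) ≠ G.vertexOf t := by
  induction n using Nat.strong_induction_on with
  | _ n ih =>
  intro T f p hn hT hTS h3 hf hnf hpf hside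
  have hff : f ≠ G.next f := (hloop f (hTS hf.1)).symm
  rcases hside with ⟨hp, hnfS⟩ | ⟨hp, hnfS⟩
  · obtain ⟨h, hh, hhS, hhp⟩ := exists_side_start hT.region hT.convex hS.region hS.convex hTS
      (p := p) (by rwa [hpf])
    have hhS := hhS hp
    have hhf : f ≠ h := by
      rintro rfl
      rcases hhp with rfl | hst
      · exact hff hpf.symm
      · exact hnf.2.1 (by rwa [next_apply, ← straight_apply])
    have hhnf : G.next f ≠ h := by
      rintro rfl
      exact hhS hnfS
    have hcor := eq_of_ncard_eq_three h3 hf hnf hh hff hhf hhnf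
    have hrh := rev_notMem_of_corners hT.region hh
    obtain ⟨i, hi⟩ := G.next.surjective h
    have hiT : i ∈ T := (hT.region i).1 (hi ▸ hh.1)
    -- If the side ending at `h` is a single edge, all three corners border one face and this face
    -- is the triangle sought. Otherwise the chord through the initial vertex of `i` cuts off a
    -- smaller triangular disc at `h`.
    by_cases hic : i ∈ G.corners T
    · have hif : i = G.next f := by
        have := hcor ▸ hic
        rcases this with rfl | rfl | rfl
        · exact absurd hi hhnf
        · rfl
        · exact absurd hi (hloop _ (hTS hiT))
      rw [hif] at hi
      have hnh : G.next h = f := by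
        have := hS.next_mem_corners hc hs hT hTS hh fun P hP hhP => by
          rw [← hi, hP, hP] at hhP
          rw [hcor]
          rintro x (rfl | rfl | rfl)
          · exact hhP
          · rwa [hP]
          · rwa [← hi, hP, hP]
        rw [hcor] at this
        rcases this with h' | h' | h'
        · exact h'
        · exact absurd (G.next.injective h') hhf.symm
        · exact absurd h' (hloop _ (hTS hh.1))
      refine ⟨h, hTS hh.1, hhS, by rw [hnh, hi], ?_, ?_, ?_⟩ <;> rw [hnh]
      · exact vertexOf_ne_of_corners hT.convex hh hf hhf.symm
      · exact vertexOf_ne_of_corners hT.convex hf hnf hff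
      · exact vertexOf_ne_of_corners hT.convex hnf hh hhnf
    · have hri : G.rev i ∉ T := by
        have := hh.2.2
        rwa [← hi, next_apply, G.rot_four] at this
      obtain ⟨c0, c1, c2⟩ := chord_of_notMem_corners hT.region hiT hri hic
      obtain ⟨F, hF, hFT, hlt, hF3, hhF, -, hiF⟩ := hS.exists_triangle_disc hc hs hT hTS c0 c1 c2 hh
        (fun P hP hhP hne => ncard_inter_le_one hP hcor hhP hne)
      rw [G.rot_four] at hiF
      have hpi : G.next (G.rev (G.rot (G.rot (G.rot i)))) = i := by
        rw [next_rev, G.rot_four]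
      -- In the smaller disc the edge side is `i`, the chord is the side before it, and the side
      -- after it runs along the boundary of the lens. So the two alternatives of the hypothesis are
      -- exchanged at each cut.
      refine ih F.ncard (by omega) F i (G.rev (G.rot (G.rot (G.rot i)))) rfl hF
        (hFT.trans hTS) hF3 (hiF hi) (by rwa [hi]) hpi (Or.inr ⟨?_, ?_⟩)
      · rw [G.rev_rev]; exact hTS c0
      · rwa [hi]
  · obtain ⟨y, hyT, hry, hyc, hyS, hyf⟩ := exists_side_end hT.region hT.convex hS.region hS.convex
      hTS hnf
    have hyS := hyS hnfS
    obtain ⟨h, hyh⟩ : ∃ h, G.next y = h := ⟨_, rfl⟩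
    rw [hyh] at hyc
    have hhf : f ≠ h := by
      rintro rfl
      rw [← G.next.injective (hpf.trans hyh.symm)] at hyS
      exact hyS hp
    have hhnf : G.next f ≠ h := by
      rintro rfl
      have := G.next.injective hyh
      subst this
      rcases hyf with h | h
      · exact hff h
      · exact h hf
    have hcor := eq_of_ncard_eq_three h3 hf hnf hyc hff hhf hhnf
    have hrh := rev_notMem_of_corners hT.region hyc
    by_cases hnc : G.next h ∈ G.corners T
    · have hnh : G.next h = f := by
        have := hcor ▸ hnc
        rcases this with h' | h' | h'
        · exact h'
        · exact absurd (G.next.injective h') hhf.symm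
        · exact absurd h' (hloop _ (hTS hyc.1))
      have hnnf : G.next (G.next f) = h := by
        have := hS.next_mem_corners hc hs hT hTS hnf fun P hP hhP => by
          rw [hP] at hhP
          rw [hcor]
          rintro x (rfl | rfl | rfl)
          · exact hhP
          · rwa [hP]
          · rwa [← hP, hnh]
        rw [hcor] at this
        rcases this with h' | h' | h'
        · exact absurd (G.next.injective (h'.trans hnh.symm)) hhnf
        · exact absurd h' (hloop _ (hTS hnf.1))
        · exact h'
      refine ⟨G.next f, hTS hnf.1, hnfS, by rw [hnnf, hnh], ?_, ?_, ?_⟩ <;> rw [hnnf]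
      · exact vertexOf_ne_of_corners hT.convex hnf hyc hhnf
      · rw [hnh]
        exact vertexOf_ne_of_corners hT.convex hyc hf hhf.symm
      · rw [hnh]
        exact vertexOf_ne_of_corners hT.convex hf hnf hff
    · obtain ⟨c0, c1, c2⟩ := chord_of_next_notMem_corners hT.region hT.convex hyc.1 hrh hnc
      obtain ⟨F, hF, hFT, hlt, hF3, hhF, hdF, -⟩ := hS.exists_triangle_disc hc hs hT hTS c0 c1 c2 hyc
        (fun P hP hhP hne => ncard_inter_le_one hP hcor hhP hne)
      refine ih F.ncard (by omega) F h y rfl hF (hFT.trans hTS) hF3 hhF (hdF rfl) hyh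
        (Or.inl ⟨hyS, ?_⟩)
      rw [hS.region.rev_mem]; exact hTS c1

/-- A minimal lens is a bigon, or has a triangular face at its boundary. -/
theorem IsMinimalLens.exists_triangle [Finite D] (hc : G.Connected) (hs : G.Spherical)
    {o : D} {S : Set D} (hS : G.IsMinimalLens o S) (hloop : ∀ d ∈ S, G.next d ≠ d)
    (hbigon : ∀ d ∈ S, G.next (G.next d) = d → G.vertexOf d = G.vertexOf (G.next d)) :
    ∃ t ∈ S, G.rev t ∉ S ∧ G.next (G.next (G.next t)) = t ∧
      G.vertexOf t ≠ G.vertexOf (G.next t) ∧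
      G.vertexOf (G.next t) ≠ G.vertexOf (G.next (G.next t)) ∧
      G.vertexOf (G.next (G.next t)) ≠ G.vertexOf t := by
  have h2 := hS.ncard_corners
  obtain ⟨b, hb, hb'⟩ := hS.exists_boundary hc
  have hne : (G.corners S).Nonempty := by
    by_contra hemp
    rw [Set.not_nonempty_iff_eq_empty] at hemp
    obtain ⟨c0, c1, c2⟩ := chord_of_notMem_corners hS.region hb hb' (by simp [hemp])
    obtain ⟨P, -, -, -, -, -, -, -, -, -, -, x, hx, -⟩ :=
      hS.exists_piece hc hs hS.toIsDisc subset_rfl c0 c1 c2 hb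
    rw [hemp] at hx
    exact hx
  -- If every corner were followed immediately by a corner, having at most two of them would produce
  -- a bigon.
  obtain ⟨e, he, hne⟩ : ∃ e ∈ G.corners S, G.next e ∉ G.corners S := by
    by_contra! hall
    obtain ⟨e, he⟩ := hne
    have he1 := hall e he
    have he2 := hall _ he1
    have hee : e ≠ G.next e := (hloop e he.1).symm
    have : G.next (G.next e) = e := by
      by_contra hne
      have h3 := Set.ncard_eq_three.2 ⟨e, G.next e, G.next (G.next e), hee, fun h => hne h.symm,
        (hloop _ he1.1).symm, rfl⟩
      have h4 : ({e, G.next e, G.next (G.next e)} : Set D) ⊆ G.corners S := by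
        rintro x (rfl | rfl | rfl) <;> assumption
      have := Set.ncard_le_ncard h4
      omega
    exact vertexOf_ne_of_corners hS.convex he he1 hee (hbigon e he.1 this)
  obtain ⟨c0, c1, c2⟩ := chord_of_next_notMem_corners hS.region hS.convex he.1
    (rev_notMem_of_corners hS.region he) hne
  -- Of the at most two corners of `S`, the piece at `e` misses one, so it keeps only `e` and is
  -- triangular.
  obtain ⟨F, hF, hFT, hlt, hF3, hhF, hdF, -⟩ :=
    hS.exists_triangle_disc hc hs hS.toIsDisc subset_rfl c0 c1 c2 he (fun P hP heP hne => by
      have h3 := Set.ncard_inter_add_ncard_sdiff_eq_ncard (G.corners S) P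
      have h4 := hne.ncard_pos
      omega)
  obtain ⟨p, hp⟩ := G.next.surjective e
  refine hS.exists_triangle_of_disc hc hs hloop F.ncard F e p rfl hF hFT hF3 hhF (hdF rfl) hp
    (Or.inl ⟨?_, ?_⟩)
  · have := he.2.2
    rwa [← hp, next_apply, G.rot_four] at this
  · rwa [hS.region.rev_mem]

end FourValentMap

/-! ### Effect of a triangle move on faces and connectedness -/

namespace FourValentMap

variable {D : Type*}

theorem IsRegion.mem_iff_of_faceOf_eq {G : FourValentMap D} {X : Set D} (hX : G.IsRegion X)
    {d e : D} (h : G.faceOf d = G.faceOf e) : d ∈ X ↔ e ∈ X := by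
  rw [faceOf_eq_iff] at h
  obtain ⟨i, rfl⟩ := h
  induction i using Int.induction_on with
  | zero => rfl
  | succ i ih =>
    rw [ih, add_comm, zpow_add, Equiv.Perm.mul_apply, zpow_one, hX]
  | pred i ih =>
    rw [ih, sub_eq_add_neg, add_comm, zpow_add, Equiv.Perm.mul_apply, zpow_neg_one, ← hX (G.next⁻¹ _)]
    simp

theorem isRegion_faceOf_preimage (G : FourValentMap D) (A : Set G.Face) :
    G.IsRegion (G.faceOf ⁻¹' A) := fun d => by
  rw [Set.mem_preimage, Set.mem_preimage, faceOf_next]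

theorem faceOf_eq_of_region {G : FourValentMap D} {d e : D}
    (h : ∀ X, G.IsRegion X → (d ∈ X ↔ e ∈ X)) : G.faceOf d = G.faceOf e :=
  (((h _ (G.isRegion_faceOf_preimage {G.faceOf d})).1 rfl : G.faceOf e = G.faceOf d)).symm

/-- Regions are sets of faces. Counting regions compares the numbers of faces of two maps without
matching single faces. -/
theorem card_region [Finite D] (G : FourValentMap D) :
    Nat.card {X // G.IsRegion X} = 2 ^ Nat.card G.Face := by
  have := Fintype.ofFinite G.Face
  classical
  rw [Nat.card_eq_fintype_card (α := G.Face), ← Fintype.card_set, ← Nat.card_eq_fintype_card]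
  refine Nat.card_congr ⟨fun X => G.faceOf '' X.1, fun A => ⟨_, G.isRegion_faceOf_preimage A⟩,
    fun X => Subtype.ext ?_, fun A => Set.image_preimage_eq A G.faceOf_surjective⟩
  ext d
  constructor
  · rintro ⟨e, he, hde⟩
    exact (X.2.mem_iff_of_faceOf_eq hde).1 he
  · exact fun hd => ⟨d, hd, rfl⟩

/-- `H` arises from `G` by a triangle move at the triangle with the sides `t i`. -/
structure IsMove (G H : FourValentMap D) (t : Fin 3 → D) : Prop where
  next_t : ∀ i, G.next (t i) = t (i + 1)
  vertexOf_injective : ∀ i j, G.vertexOf (t i) = G.vertexOf (t j) → i = j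
  rev_eq : H.rev = G.rev
  conj : ∃ s : Equiv.Perm D, H.rot = s * G.rot * s⁻¹
  rot_t : ∀ i, H.rot (t i) = G.rot (G.rot (t (i + 1)))
  rot_w : ∀ i, H.rot (G.rot (G.rot (t (i + 1)))) = G.rot (t i)
  rot_u : ∀ i, H.rot (G.rot (t (i + 1))) = G.rev (t i)
  rot_r : ∀ i, H.rot (G.rev (t i)) = t (i + 1)
  rot_other : ∀ x, (∀ i, G.vertexOf x ≠ G.vertexOf (t i)) → H.rot x = G.rot x

namespace IsMove

variable {G H : FourValentMap D} {t : Fin 3 → D} (h : G.IsMove H t)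
include h

theorem rot_rev (i : Fin 3) : G.rot (G.rev (t i)) = t (i + 1) := h.next_t i

theorem rot_rot_rot (i : Fin 3) : G.rot (G.rot (G.rot (t (i + 1)))) = G.rev (t i) := by
  apply G.rot.injective
  rw [G.rot_four, h.rot_rev]

theorem vertexOf_rev (i : Fin 3) : G.vertexOf (G.rev (t i)) = G.vertexOf (t (i + 1)) := by
  rw [← h.rot_rev, vertexOf_rot]

theorem cases (x : D) : (∃ i, x = t i) ∨ (∃ i, x = G.rot (t i)) ∨
    (∃ i, x = G.rot (G.rot (t (i + 1)))) ∨ (∃ i, x = G.rev (t i)) ∨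
    ∀ i, G.vertexOf x ≠ G.vertexOf (t i) := by
  by_cases hx : ∃ i, G.vertexOf x = G.vertexOf (t i)
  · obtain ⟨i, hi⟩ := hx
    obtain ⟨j, rfl⟩ : ∃ j, i = j + 1 := ⟨i - 1, by simp⟩
    rcases (G.vertexOf_eq_iff _ _).1 hi.symm with rfl | rfl | rfl | rfl
    · exact Or.inl ⟨_, rfl⟩
    · exact Or.inr (Or.inl ⟨_, rfl⟩)
    · exact Or.inr (Or.inr (Or.inl ⟨_, rfl⟩))
    · exact Or.inr (Or.inr (Or.inr (Or.inl ⟨j, h.rot_rot_rot j⟩)))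
  · push Not at hx
    exact Or.inr (Or.inr (Or.inr (Or.inr hx)))

theorem t_injective {i j : Fin 3} (hij : t i = t j) : i = j :=
  h.vertexOf_injective i j (by rw [hij])

theorem r_injective {i j : Fin 3} (hij : G.rev (t i) = G.rev (t j)) : i = j :=
  h.t_injective (G.rev.injective hij)

theorem u_ne_t (i j : Fin 3) : G.rot (t i) ≠ t j := fun hij => by
  have := h.vertexOf_injective i j (by rw [← hij, vertexOf_rot])
  subst this
  exact G.rot_ne _ hij

theorem w_ne_t (i j : Fin 3) : G.rot (G.rot (t i)) ≠ t j := fun hij => by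
  have := h.vertexOf_injective i j (by rw [← hij, vertexOf_rot, vertexOf_rot])
  subst this
  exact G.rot_two_ne _ hij

theorem r_ne_t (i j : Fin 3) : G.rev (t i) ≠ t j := fun hij => by
  rw [← h.rot_rot_rot] at hij
  have := h.vertexOf_injective (i + 1) j (by rw [← hij, vertexOf_rot, vertexOf_rot, vertexOf_rot])
  subst this
  exact G.rot_three_ne _ hij

theorem u_ne_r (i j : Fin 3) : G.rot (t i) ≠ G.rev (t j) := fun hij => by
  have := h.vertexOf_injective i (j + 1) (by rw [← h.vertexOf_rev, ← hij, vertexOf_rot])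
  subst this
  rw [← h.rot_rot_rot] at hij
  exact G.rot_two_ne _ hij.symm

theorem w_ne_r (i j : Fin 3) : G.rot (G.rot (t i)) ≠ G.rev (t j) := fun hij => by
  have := h.vertexOf_injective i (j + 1)
    (by rw [← h.vertexOf_rev, ← hij, vertexOf_rot, vertexOf_rot])
  subst this
  rw [← h.rot_rot_rot] at hij
  exact G.rot_ne _ hij.symm

theorem other_ne_r {x : D} (hx : ∀ i, G.vertexOf x ≠ G.vertexOf (t i)) (i : Fin 3) :
    x ≠ G.rev (t i) := fun hi => hx (i + 1) (by rw [hi, h.vertexOf_rev])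

omit h in
theorem next_r (i : Fin 3) : G.next (G.rev (t i)) = G.rot (t i) := next_rev _ _

theorem Hnext_r (i : Fin 3) : H.next (G.rev (t i)) = G.rot (G.rot (t (i + 1))) := by
  rw [← h.rev_eq, next_rev, h.rot_t]

theorem Hnext_t (i : Fin 3) : H.next (t i) = t (i + 1) := by
  rw [next_apply, h.rev_eq, h.rot_r]

/-- The region with the darts `v i` deciding about the reversed sides of the triangle. -/
def transfer (G : FourValentMap D) (t v : Fin 3 → D) (X : Set D) : Set D :=
  {x | (∃ i, x = G.rev (t i) ∧ v i ∈ X) ∨ ((∀ i, x ≠ G.rev (t i)) ∧ x ∈ X)}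

theorem r_mem_transfer (v : Fin 3 → D) (X : Set D) (i : Fin 3) :
    G.rev (t i) ∈ transfer G t v X ↔ v i ∈ X := by
  constructor
  · rintro (⟨j, hj, hv⟩ | ⟨hn, -⟩)
    · rwa [h.r_injective hj]
    · exact absurd rfl (hn i)
  · exact fun hv => Or.inl ⟨i, rfl, hv⟩

omit h in
theorem mem_transfer (v : Fin 3 → D) (X : Set D) {x : D} (hx : ∀ i, x ≠ G.rev (t i)) :
    x ∈ transfer G t v X ↔ x ∈ X := by
  constructor
  · rintro (⟨i, hi, -⟩ | ⟨-, hm⟩)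
    · exact absurd hi (hx i)
    · exact hm
  · exact fun hm => Or.inr ⟨hx, hm⟩

theorem rev_cases (x : D) : (∃ i, x = t i) ∨ (∃ i, x = G.rev (t i)) ∨
    ((∀ i, x ≠ G.rev (t i)) ∧ (∀ i, x ≠ t i) ∧
      ((∃ i, G.rev x = G.rot (t (i + 1))) ∨ (∃ i, G.rev x = G.rot (G.rot (t (i + 1)))) ∨
        ∀ i, G.vertexOf (G.rev x) ≠ G.vertexOf (t i))) := by
  by_cases h1 : ∃ i, x = t i
  · exact Or.inl h1
  by_cases h2 : ∃ i, x = G.rev (t i)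
  · exact Or.inr (Or.inl h2)
  push Not at h1 h2
  refine Or.inr (Or.inr ⟨h2, h1, ?_⟩)
  rcases h.cases (G.rev x) with ⟨i, hi⟩ | ⟨i, hi⟩ | ⟨i, hi⟩ | ⟨i, hi⟩ | hi
  · exact absurd (by rw [← hi, G.rev_rev]) (h2 i)
  · exact Or.inl ⟨i - 1, by rwa [sub_add_cancel]⟩
  · exact Or.inr (Or.inl ⟨i, hi⟩)
  · exact absurd (G.rev.injective hi) (h1 i)
  · exact Or.inr (Or.inr hi)

/-- Only the reversed sides change their face. Before the move `rev (t i)` is on the face of `rot (t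
i)`, beside the triangle; afterwards it is on the face of `rot (rot (t (i + 1)))`, which was
opposite the triangle at a vertex. -/
theorem isRegion_transfer {X : Set D} (hX : G.IsRegion X) :
    H.IsRegion (transfer G t (fun i => G.rot (G.rot (t (i + 1)))) X) := by
  intro x
  rcases h.rev_cases x with ⟨i, rfl⟩ | ⟨i, rfl⟩ | ⟨hx, -, ⟨i, hi⟩ | ⟨i, hi⟩ | hi⟩
  · rw [h.Hnext_t, mem_transfer _ _ (fun j => (h.r_ne_t j _).symm),
      mem_transfer _ _ (fun j => (h.r_ne_t j _).symm), ← h.next_t, hX]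
  · rw [h.Hnext_r, mem_transfer _ _ (fun j => h.w_ne_r _ j), h.r_mem_transfer]
  · rw [next_apply, h.rev_eq, hi, h.rot_u, h.r_mem_transfer, mem_transfer _ _ hx, ← hX x,
      next_apply, hi]
  · rw [next_apply, h.rev_eq, hi, h.rot_w, mem_transfer _ _ (fun j => h.u_ne_r _ j),
      mem_transfer _ _ hx, ← hX x, next_apply, hi, h.rot_rot_rot, ← next_r, hX]
  · rw [next_apply, h.rev_eq, h.rot_other _ hi, mem_transfer _ _ (h.other_ne_r (fun j => by
      rw [vertexOf_rot]; exact hi j)), mem_transfer _ _ hx, ← next_apply, hX]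

theorem isRegion_transfer_symm {X : Set D} (hX : H.IsRegion X) :
    G.IsRegion (transfer G t (fun i => G.rot (t i)) X) := by
  intro x
  rcases h.rev_cases x with ⟨i, rfl⟩ | ⟨i, rfl⟩ | ⟨hx, -, ⟨i, hi⟩ | ⟨i, hi⟩ | hi⟩
  · rw [h.next_t, mem_transfer _ _ (fun j => (h.r_ne_t j _).symm),
      mem_transfer _ _ (fun j => (h.r_ne_t j _).symm), ← h.Hnext_t, hX]
  · rw [next_r, mem_transfer _ _ (fun j => h.u_ne_r _ j), h.r_mem_transfer]
  · rw [next_apply, hi, mem_transfer _ _ (fun j => h.w_ne_r _ j), mem_transfer _ _ hx, ← hX x,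
      next_apply, h.rev_eq, hi, h.rot_u, ← hX (G.rev _), h.Hnext_r]
  · rw [next_apply, hi, h.rot_rot_rot, h.r_mem_transfer,
      mem_transfer _ _ hx, ← hX x, next_apply, h.rev_eq, hi, h.rot_w]
  · rw [next_apply, mem_transfer _ _ (h.other_ne_r (fun j => by
      rw [vertexOf_rot]; exact hi j)), mem_transfer _ _ hx, ← hX x, next_apply, h.rev_eq,
      h.rot_other _ hi]

theorem transfer_transfer {X : Set D} (hX : G.IsRegion X) :
    transfer G t (fun i => G.rot (t i))
      (transfer G t (fun i => G.rot (G.rot (t (i + 1)))) X) = X := by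
  ext x
  by_cases hx : ∃ i, x = G.rev (t i)
  · obtain ⟨i, rfl⟩ := hx
    rw [h.r_mem_transfer, mem_transfer _ _ (fun j => h.u_ne_r _ j), ← next_r, hX]
  · push Not at hx
    rw [mem_transfer _ _ hx, mem_transfer _ _ hx]

theorem transfer_transfer_symm {X : Set D} (hX : H.IsRegion X) :
    transfer G t (fun i => G.rot (G.rot (t (i + 1))))
      (transfer G t (fun i => G.rot (t i)) X) = X := by
  ext x
  by_cases hx : ∃ i, x = G.rev (t i)
  · obtain ⟨i, rfl⟩ := hx
    rw [h.r_mem_transfer, mem_transfer _ _ (fun j => h.w_ne_r _ j), ← h.Hnext_r, hX]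
  · push Not at hx
    rw [mem_transfer _ _ hx, mem_transfer _ _ hx]

theorem card_face [Finite D] : Nat.card H.Face = Nat.card G.Face := by
  have h1 : Nat.card {X // H.IsRegion X} = Nat.card {X // G.IsRegion X} :=
    Nat.card_congr ⟨fun X => ⟨_, h.isRegion_transfer_symm X.2⟩,
      fun X => ⟨_, h.isRegion_transfer X.2⟩, fun X => Subtype.ext (h.transfer_transfer_symm X.2),
      fun X => Subtype.ext (h.transfer_transfer X.2)⟩
  rw [card_region, card_region] at h1
  exact Nat.pow_right_injective le_rfl h1

theorem faceOf_eq_iff {d e : D} (hd : ∀ i, d ≠ G.rev (t i)) (he : ∀ i, e ≠ G.rev (t i)) :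
    H.faceOf d = H.faceOf e ↔ G.faceOf d = G.faceOf e := by
  constructor <;> intro hde <;> refine faceOf_eq_of_region fun X hX => ?_
  · have := (h.isRegion_transfer hX).mem_iff_of_faceOf_eq hde
    rwa [mem_transfer _ _ hd, mem_transfer _ _ he] at this
  · have := (h.isRegion_transfer_symm hX).mem_iff_of_faceOf_eq hde
    rwa [mem_transfer _ _ hd, mem_transfer _ _ he] at this

theorem spherical [Finite D] (hs : G.Spherical) : H.Spherical := by
  have hV : Nat.card H.Vertex = Nat.card G.Vertex := by
    obtain ⟨s, hs⟩ := h.conj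
    refine Nat.card_congr (Quotient.congr s⁻¹ fun a b => ?_)
    change H.rot.SameCycle a b ↔ G.rot.SameCycle (s⁻¹ a) (s⁻¹ b)
    rw [hs, Equiv.Perm.sameCycle_conj]
  have hE : Nat.card H.Edge = Nat.card G.Edge := by
    unfold Edge
    rw [h.rev_eq]
  have hs' : Nat.card G.Vertex + Nat.card G.Face = Nat.card G.Edge + 2 := hs
  unfold Spherical
  rw [hV, hE, h.card_face, hs']

/-- Each of the three new vertices contains one of the darts `t i`, and these stay linked in a
cycle. So a closed set meeting one new vertex contains the darts of all three, that is, of all three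
old vertices. -/
theorem connected [Finite D] (hc : G.Connected) : H.Connected := by
  refine Connected.of_closed fun A hrot hrev d hd e => ?_
  rw [h.rev_eq] at hrev
  have ht : ∀ i, t i ∈ A → t (i + 1) ∈ A := fun i hi => by
    have := hrot _ (hrev _ hi)
    rwa [h.rot_r] at this
  have hall : ∀ i, t i ∈ A → ∀ j, t j ∈ A := fun i hi j => by
    have : j = i ∨ j = i + 1 ∨ j = i + 1 + 1 := by
      clear * -
      revert i j; decide
    rcases this with rfl | rfl | rfl
    · exact hi
    · exact ht _ hi
    · exact ht _ (ht _ hi)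
  have hr : ∀ i, G.rev (t i) ∈ A → t (i + 1) ∈ A := fun i hi => by
    rw [← h.rot_r]; exact hrot _ hi
  have hu : ∀ i, G.rot (t (i + 1)) ∈ A → t (i + 1) ∈ A := fun i hi => by
    refine hr i ?_
    rw [← h.rot_u]; exact hrot _ hi
  have hw : ∀ i, G.rot (G.rot (t (i + 1))) ∈ A → t i ∈ A := fun i hi => by
    obtain ⟨j, rfl⟩ : ∃ j, i = j + 1 := ⟨i - 1, by simp⟩
    refine hu _ ?_
    rw [← h.rot_w]; exact hrot _ hi
  have hw' : ∀ i, t i ∈ A → G.rot (G.rot (t (i + 1))) ∈ A := fun i hi => by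
    rw [← h.rot_t]; exact hrot _ hi
  refine hc.mem_of_closed (fun x hx => ?_) hrev hd e
  rcases h.cases x with ⟨i, rfl⟩ | ⟨i, rfl⟩ | ⟨i, rfl⟩ | ⟨i, rfl⟩ | hx'
  · rw [← h.rot_w]; exact hrot _ (hw' _ hx)
  · obtain ⟨j, rfl⟩ : ∃ j, i = j + 1 := ⟨i - 1, by simp⟩
    exact hw' _ (hall _ (hu _ hx) _)
  · rw [h.rot_rot_rot]; exact hrev _ (hw _ hx)
  · rw [h.rot_rev]; exact hr _ hx
  · rw [← h.rot_other x hx']; exact hrot _ hx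

/-- A loop arising in a triangle move comes from a bigon. -/
theorem loop_cases {e : D} (he : H.next e = e) : (∀ i, e ≠ G.rev (t i)) ∧ (∀ i, e ≠ t i) ∧
    (G.next e = e ∨ (G.next (G.next e) = e ∧ G.vertexOf e ≠ G.vertexOf (G.next e))) := by
  have hne : ∀ i : Fin 3, i + 1 ≠ i := by decide
  rcases h.rev_cases e with ⟨i, rfl⟩ | ⟨i, rfl⟩ | ⟨hr, ht, hi⟩
  · rw [h.Hnext_t] at he
    exact absurd (h.t_injective he) (hne i)
  · rw [h.Hnext_r] at he
    exact absurd he (h.w_ne_r _ _)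
  · refine ⟨hr, ht, ?_⟩
    rcases hi with ⟨i, hi⟩ | ⟨i, hi⟩ | hi
    · rw [next_apply, h.rev_eq, hi, h.rot_u] at he
      exact absurd he.symm (hr i)
    · rw [next_apply, h.rev_eq, hi, h.rot_w] at he
      have h1 : G.next e = G.rev (t i) := by rw [next_apply, hi, h.rot_rot_rot]
      refine Or.inr ⟨by rw [h1, next_r, he], ?_⟩
      rw [h1, h.vertexOf_rev, ← he, vertexOf_rot]
      exact fun hv => hne i (h.vertexOf_injective _ _ hv.symm)
    · rw [next_apply, h.rev_eq, h.rot_other _ hi] at he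
      exact Or.inl he

/-! ### Effect of a triangle move on a lens -/

section lens

variable {S : Set D}

/-- What remains of a region when a triangle is moved out of it. -/
def moved (G : FourValentMap D) (t : Fin 3 → D) (S : Set D) : Set D :=
  {x ∈ transfer G t (fun i => G.rot (G.rot (t (i + 1)))) S | ∀ i, x ≠ t i}

omit h in
theorem mem_moved {x : D} (hx : ∀ i, x ≠ G.rev (t i)) (hx' : ∀ i, x ≠ t i) :
    x ∈ moved G t S ↔ x ∈ S :=
  (and_iff_left hx').trans (mem_transfer _ _ hx)

omit h in
theorem t_notMem_moved (i : Fin 3) : t i ∉ moved G t S := fun hm => hm.2 i rfl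

theorem r_mem_moved (i : Fin 3) : G.rev (t i) ∈ moved G t S ↔ G.rot (G.rot (t (i + 1))) ∈ S :=
  (and_iff_left fun j => h.r_ne_t i j).trans (h.r_mem_transfer _ _ i)

theorem u_mem_moved (i : Fin 3) : G.rot (t i) ∈ moved G t S ↔ G.rot (t i) ∈ S :=
  mem_moved (h.u_ne_r i) (h.u_ne_t i)

theorem w_mem_moved (i : Fin 3) :
    G.rot (G.rot (t i)) ∈ moved G t S ↔ G.rot (G.rot (t i)) ∈ S :=
  mem_moved (h.w_ne_r i) (h.w_ne_t i)

theorem other_mem_moved {x : D} (hx : ∀ i, G.vertexOf x ≠ G.vertexOf (t i)) :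
    x ∈ moved G t S ↔ x ∈ S :=
  mem_moved (h.other_ne_r hx) fun i hi => hx i (by rw [hi])

theorem isRegion_moved (hS : G.IsRegion S) : H.IsRegion (moved G t S) := by
  intro x
  refine and_congr (h.isRegion_transfer hS x) ⟨fun hn i hi => ?_, fun hn i hi => ?_⟩
  · exact hn (i + 1) (by rw [hi, h.Hnext_t])
  · have : t i = H.next (t (i - 1)) := by rw [h.Hnext_t, sub_add_cancel]
    rw [this] at hi
    exact hn _ (H.next.injective hi)

variable (hS : G.IsRegion S) (hconv : G.IsConvex S) (ht : ∀ i, t i ∈ S)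
include hS hconv ht

omit hS in
theorem of_w_mem {i : Fin 3} (hw : G.rot (G.rot (t (i + 1))) ∈ S) :
    G.rot (t (i + 1)) ∈ S ∧ G.rev (t i) ∈ S := by
  refine ⟨hconv _ (ht _) hw, ?_⟩
  rw [← h.rot_rot_rot]
  refine hconv _ hw ?_
  rw [G.rot_four]
  exact ht _

omit hS in
theorem moved_subset : moved G t S ⊆ S := by
  rintro x ⟨⟨i, rfl, hi⟩ | ⟨-, hx⟩, -⟩
  · exact (h.of_w_mem hconv ht hi).2
  · exact hx

omit hS in
theorem moved_ncard_lt [Finite D] : (moved G t S).ncard < S.ncard :=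
  Set.ncard_lt_ncard ((h.moved_subset hconv ht).ssubset_of_mem_notMem (ht 0)
    (t_notMem_moved 0))

/-- Convexity could fail only at a vertex of the new triangle, with the triangle as the missing
corner. Then two of the corners opposite the old triangle would be in `S`, and convexity of `S`
would put all three reversed sides in `S`, against `hk`. -/
theorem isConvex_moved {k : Fin 3} (hk : G.rev (t k) ∉ S) : H.IsConvex (moved G t S) := by
  have hru : ∀ i, G.rev (t i) ∈ S ↔ G.rot (t i) ∈ S := fun i => hS.rev_mem _
  intro d hd hd2
  rcases h.cases d with ⟨i, rfl⟩ | ⟨i, rfl⟩ | ⟨i, rfl⟩ | ⟨i, rfl⟩ | hx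
  · exact absurd hd (t_notMem_moved i)
  · obtain ⟨j, rfl⟩ : ∃ j, i = j + 1 := ⟨i - 1, by simp⟩
    rw [h.rot_u, h.rot_r] at hd2
    exact absurd hd2 (t_notMem_moved _)
  · rw [h.w_mem_moved] at hd
    rw [h.rot_w, h.u_mem_moved, ← hru]
    exact (h.of_w_mem hconv ht hd).2
  · rw [h.r_mem_moved] at hd
    rw [h.rot_r, h.rot_t, h.w_mem_moved] at hd2
    exfalso
    obtain ⟨h1, h2⟩ := h.of_w_mem hconv ht hd
    obtain ⟨h3, -⟩ := h.of_w_mem hconv ht hd2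
    rw [← hru] at h1 h3
    have : k = i ∨ k = i + 1 ∨ k = i + 1 + 1 := by
      clear * -
      revert i k; decide
    rcases this with rfl | rfl | rfl <;> exact hk ‹_›
  · have hx1 : ∀ i, G.vertexOf (G.rot d) ≠ G.vertexOf (t i) := fun i => by
      rw [vertexOf_rot]; exact hx i
    have hx2 : ∀ i, G.vertexOf (G.rot (G.rot d)) ≠ G.vertexOf (t i) := fun i => by
      rw [vertexOf_rot]; exact hx1 i
    rw [h.other_mem_moved hx] at hd
    rw [h.rot_other _ hx, h.rot_other _ hx1, h.other_mem_moved hx2] at hd2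
    rw [h.rot_other _ hx, h.other_mem_moved hx1]
    exact hconv _ hd hd2

omit hS in
-- Connections in the old complement carry over by `transfer`. The new triangle, now outside, is
-- joined to it across side `k`, which lies on the boundary.
theorem isCoconnected_moved (hco : G.IsCoconnected S) {k : Fin 3} (hk : G.rev (t k) ∉ S) :
    H.IsCoconnected (moved G t S) := by
  intro X hX hcl d hd hdM e heM
  rw [h.rev_eq] at hcl
  have hX' := h.isRegion_transfer_symm hX
  have hcl' : ∀ x ∈ transfer G t (fun i => G.rot (t i)) X, x ∉ S → G.rev x ∉ S →
      G.rev x ∈ transfer G t (fun i => G.rot (t i)) X := by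
    intro x hx hxS hxS'
    have h1 : ∀ i, x ≠ G.rev (t i) := by
      rintro i rfl
      rw [G.rev_rev] at hxS'
      exact hxS' (ht i)
    have h2 : ∀ i, G.rev x ≠ G.rev (t i) := fun i hi => hxS (G.rev.injective hi ▸ ht i)
    rw [mem_transfer _ _ h1] at hx
    rw [mem_transfer _ _ h2]
    exact hcl x hx (fun hm => hxS (h.moved_subset hconv ht hm))
      (fun hm => hxS' (h.moved_subset hconv ht hm))
  have hw : ∀ i, G.rot (G.rot (t (i + 1))) ∈ X ↔ G.rev (t i) ∈ X := fun i => by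
    rw [← h.Hnext_r, hX]
  have hkS : G.rot (G.rot (t (k + 1))) ∉ S := fun hm => hk (h.of_w_mem hconv ht hm).2
  have hiff : ∀ x, x ∉ S → (∀ i, x ≠ G.rev (t i)) → (x ∈ X ↔ G.rot (G.rot (t (k + 1))) ∈ X) := by
    intro x hx hxr
    have key := hco _ hX' hcl'
    constructor
    · intro hm
      have := key x ((mem_transfer _ _ hxr).2 hm) hx _ hkS
      rwa [mem_transfer _ _ (h.w_ne_r _)] at this
    · intro hm
      have := key _ ((mem_transfer _ _ (h.w_ne_r _)).2 hm) hkS x hx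
      rwa [mem_transfer _ _ hxr] at this
  have htk : ∀ i, t i ∈ X ↔ t k ∈ X := by
    have h1 : ∀ i, t (i + 1) ∈ X ↔ t i ∈ X := fun i => by rw [← h.Hnext_t, hX]
    intro i
    have : i = k ∨ i = k + 1 ∨ i = k + 1 + 1 := by
      clear * -
      revert i k; decide
    rcases this with rfl | rfl | rfl
    · rfl
    · exact h1 _
    · rw [h1, h1]
  have hall : ∀ x, x ∉ moved G t S → (x ∈ X ↔ G.rot (G.rot (t (k + 1))) ∈ X) := by
    intro x hx
    by_cases h1 : ∃ i, x = G.rev (t i)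
    · obtain ⟨i, rfl⟩ := h1
      rw [h.r_mem_moved] at hx
      rw [← hw]
      exact hiff _ hx (h.w_ne_r _)
    push Not at h1
    by_cases h2 : ∃ i, x = t i
    · obtain ⟨i, rfl⟩ := h2
      have h3 := fun hm => hk (h.moved_subset hconv ht hm)
      rw [htk, hw]
      refine ⟨fun hm => hcl _ hm (t_notMem_moved k) h3, fun hm => ?_⟩
      have := hcl _ hm h3 (by rw [G.rev_rev]; exact t_notMem_moved k)
      rwa [G.rev_rev] at this
    push Not at h2
    rw [mem_moved h1 h2] at hx
    exact hiff x hx h1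
  exact (hall e heM).2 ((hall d hdM).1 hd)

open Classical in
theorem ncard_corners_moved_le [Finite D] :
    (H.corners (moved G t S)).ncard ≤ (G.corners S).ncard := by
  have hru : ∀ i, G.rev (t i) ∈ S ↔ G.rot (t i) ∈ S := fun i => hS.rev_mem _
  -- A corner of the remainder at `rot (t (j + 1))` is the new crossing of the two arcs that used to
  -- cross at the corner `t j` of `S`; `g` sends the old corner to the new one.
  let g : D → D := fun x => if hx : ∃ i, x = t i then G.rot (t (hx.choose + 1)) else x
  have hg : ∀ i, g (t i) = G.rot (t (i + 1)) := by
    intro i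
    have hx : ∃ j, t i = t j := ⟨i, rfl⟩
    have h1 : g (t i) = G.rot (t (hx.choose + 1)) := dif_pos hx
    rw [h1, ← h.t_injective hx.choose_spec]
  have hsub : H.corners (moved G t S) ⊆ g '' G.corners S := by
    rintro x ⟨h0, h1, h3⟩
    rcases h.cases x with ⟨i, rfl⟩ | ⟨i, rfl⟩ | ⟨i, rfl⟩ | ⟨i, rfl⟩ | hx
    · exact absurd h0 (t_notMem_moved i)
    · obtain ⟨j, rfl⟩ : ∃ j, i = j + 1 := ⟨i - 1, by simp⟩
      rw [h.u_mem_moved] at h0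
      rw [h.rot_u, h.r_mem_moved] at h1
      rw [h.rot_u, h.rot_r, h.rot_t, h.w_mem_moved] at h3
      have hw : ∀ i, G.rot (t (i + 1)) ∈ S → G.rev (t i) ∈ S →
          G.rot (G.rot (t (i + 1))) ∈ S := fun i a b => by
        refine hconv _ a ?_
        rwa [h.rot_rot_rot]
      refine ⟨t j, ⟨ht j, fun hu => h1 (hw _ h0 ((hru j).2 hu)), fun hr => h3 ?_⟩, hg j⟩
      have hj : j = j + 1 + 1 + 1 := by clear * -; revert j; decide
      rw [hj, h.rot_rot_rot, hru] at hr
      exact hw _ hr ((hru _).2 h0)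
    · exfalso
      rw [h.w_mem_moved] at h0
      rw [h.rot_w, h.u_mem_moved, ← hru] at h1
      exact h1 (h.of_w_mem hconv ht h0).2
    · exfalso
      rw [h.r_mem_moved] at h0
      rw [h.rot_r, h.rot_t, h.rot_w, h.u_mem_moved] at h3
      exact h3 (h.of_w_mem hconv ht h0).1
    · have hx1 : ∀ i, G.vertexOf (G.rot x) ≠ G.vertexOf (t i) := fun i => by
        rw [vertexOf_rot]; exact hx i
      have hx2 : ∀ i, G.vertexOf (G.rot (G.rot x)) ≠ G.vertexOf (t i) := fun i => by
        rw [vertexOf_rot]; exact hx1 i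
      have hx3 : ∀ i, G.vertexOf (G.rot (G.rot (G.rot x))) ≠ G.vertexOf (t i) := fun i => by
        rw [vertexOf_rot]; exact hx2 i
      rw [h.other_mem_moved hx] at h0
      rw [h.rot_other _ hx, h.other_mem_moved hx1] at h1
      rw [h.rot_other _ hx, h.rot_other _ hx1, h.rot_other _ hx2, h.other_mem_moved hx3] at h3
      refine ⟨x, ⟨h0, h1, h3⟩, dif_neg ?_⟩
      rintro ⟨i, rfl⟩
      exact hx i rfl
  exact (Set.ncard_le_ncard hsub).trans (Set.ncard_image_le (Set.toFinite _))

omit hconv in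
-- If nothing remained, `S` would not continue across any side of the triangle, so all three
-- vertices of the triangle would be corners of `S`.
theorem moved_nonempty [Finite D] (hcard : (G.corners S).ncard ≤ 2) : (moved G t S).Nonempty := by
  by_contra hne
  have hu : ∀ i, G.rot (t i) ∉ S := fun i hi => hne ⟨_, (h.u_mem_moved i).2 hi⟩
  have hcor : ∀ i, t i ∈ G.corners S := fun i => by
    obtain ⟨j, rfl⟩ : ∃ j, i = j + 1 := ⟨i - 1, by simp⟩
    refine ⟨ht _, hu _, ?_⟩
    rw [h.rot_rot_rot, hS.rev_mem]
    exact hu j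
  have h1 : ({t 0, t 1, t 2} : Set D) ⊆ G.corners S := by
    rintro x (rfl | rfl | rfl) <;> exact hcor _
  have h2 := Set.ncard_eq_three.2 ⟨t 0, t 1, t 2, fun h' => absurd (h.t_injective h') (by decide),
    fun h' => absurd (h.t_injective h') (by decide),
    fun h' => absurd (h.t_injective h') (by decide), rfl⟩
  have := Set.ncard_le_ncard h1
  omega

end lens

end IsMove

end FourValentMap

/-! ### Triangle moves of plane graphs and the descent -/

namespace PlaneFourValentGraph

open FourValentMap

variable {D : Type*}

theorem notMem_of_faceOf_eq {G : FourValentMap D} {o d : D} {S : Set D} (hS : G.IsRegion S)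
    (ho : o ∉ S) (h : d ∈ S) : G.faceOf d ≠ G.faceOf o :=
  fun hd => ho ((hS.mem_iff_of_faceOf_eq hd).1 h)

/-- The sides of the triangle to the left of `d`. -/
def triangleSide (G : FourValentMap D) (d : D) : Fin 3 → D := ![d, G.next d, G.next (G.next d)]

/-- The map obtained by moving the triangle to the left of `d`. -/
def movedMap [DecidableEq D] (G : PlaneFourValentGraph D) (d : D) : FourValentMap D where
  rot := G.shift d * G.rot * (G.shift d)⁻¹
  rev := G.rev
  rev_rev := G.rev_rev
  rev_ne := G.rev_ne
  rot_four x := by simp [G.rot_four]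
  rot_two_ne x hx := by
    refine G.rot_two_ne ((G.shift d)⁻¹ x) ?_
    have := congrArg (⇑(G.shift d)⁻¹) hx
    simpa using this

section

variable {G : PlaneFourValentGraph D} {d : D}

theorem IsTriangle.next_side (hd : G.IsTriangle d) (i : Fin 3) :
    G.next (triangleSide G.toFourValentMap d i) = triangleSide G.toFourValentMap d (i + 1) := by
  fin_cases i
  · rfl
  · rfl
  · exact hd.1

theorem IsTriangle.vertexOf_side_injective (hd : G.IsTriangle d) (i j : Fin 3)
    (h : G.vertexOf (triangleSide G.toFourValentMap d i) =
      G.vertexOf (triangleSide G.toFourValentMap d j)) : i = j := by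
  obtain ⟨-, h1, h2, h3, -⟩ := hd
  fin_cases i <;> fin_cases j
  · rfl
  · exact absurd h h1
  · exact absurd h.symm h3
  · exact absurd h.symm h1
  · rfl
  · exact absurd h h2
  · exact absurd h h3
  · exact absurd h.symm h2
  · rfl

theorem legs_eq (G : PlaneFourValentGraph D) (d : D) : G.legs d =
    [G.rot (G.rot (triangleSide G.toFourValentMap d 0)), G.rot (triangleSide G.toFourValentMap d 0),
      G.rot (G.rot (triangleSide G.toFourValentMap d 1)), G.rot (triangleSide G.toFourValentMap d 1),
      G.rot (G.rot (triangleSide G.toFourValentMap d 2)),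
      G.rot (triangleSide G.toFourValentMap d 2)] := rfl

theorem IsTriangle.nodup_legs (hd : G.IsTriangle d) : (G.legs d).Nodup := by
  have hv := hd.vertexOf_side_injective
  have huu : ∀ i j, i ≠ j → G.rot (triangleSide G.toFourValentMap d i) ≠
      G.rot (triangleSide G.toFourValentMap d j) := fun i j hij h =>
    hij (hv i j (by rw [G.rot.injective h]))
  have huw : ∀ i j, G.rot (triangleSide G.toFourValentMap d i) ≠
      G.rot (G.rot (triangleSide G.toFourValentMap d j)) := fun i j h => by
    have := hv i j (by rw [G.rot.injective h, vertexOf_rot])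
    subst this
    exact G.rot_ne _ h.symm
  have hww : ∀ i j, i ≠ j → G.rot (G.rot (triangleSide G.toFourValentMap d i)) ≠
      G.rot (G.rot (triangleSide G.toFourValentMap d j)) := fun i j hij h =>
    huu i j hij (G.rot.injective h)
  rw [legs_eq]
  simp only [List.nodup_cons, List.mem_cons, List.not_mem_nil, or_false, not_or, not_false_eq_true,
    List.nodup_nil, and_true]
  refine ⟨⟨(huw 0 0).symm, hww 0 1 (by decide), (huw 1 0).symm, hww 0 2 (by decide),
    (huw 2 0).symm⟩, ⟨huw 0 1, huu 0 1 (by decide), huw 0 2, huu 0 2 (by decide)⟩,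
    ⟨(huw 1 1).symm, hww 1 2 (by decide), (huw 2 1).symm⟩, ⟨huw 1 2, huu 1 2 (by decide)⟩,
    (huw 2 2).symm⟩

variable [DecidableEq D]

theorem IsTriangle.shift_w (hd : G.IsTriangle d) (i : Fin 3) :
    G.shift d (G.rot (G.rot (triangleSide G.toFourValentMap d i))) =
      G.rot (triangleSide G.toFourValentMap d i) := by
  have := List.formPerm_apply_getElem _ hd.nodup_legs
  fin_cases i
  · exact this 0 (by simp [legs])
  · exact this 2 (by simp [legs])
  · exact this 4 (by simp [legs])

theorem IsTriangle.shift_u (hd : G.IsTriangle d) (i : Fin 3) :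
    G.shift d (G.rot (triangleSide G.toFourValentMap d i)) =
      G.rot (G.rot (triangleSide G.toFourValentMap d (i + 1))) := by
  have := List.formPerm_apply_getElem _ hd.nodup_legs
  fin_cases i
  · exact this 1 (by simp [legs])
  · exact this 3 (by simp [legs])
  -- The last leg goes around to the first.
  · exact List.formPerm_apply_getLast _ [_, _, _, _, _]

theorem shift_other {x : D}
    (hu : ∀ i, x ≠ G.rot (triangleSide G.toFourValentMap d i))
    (hw : ∀ i, x ≠ G.rot (G.rot (triangleSide G.toFourValentMap d i))) : G.shift d x = x := by
  refine List.formPerm_apply_of_notMem ?_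
  rw [legs_eq]
  simp [hu, hw]

theorem IsTriangle.isMove (hd : G.IsTriangle d) :
    G.toFourValentMap.IsMove (movedMap G d) (triangleSide G.toFourValentMap d) := by
  set t := triangleSide G.toFourValentMap d with ht
  have hrot : ∀ x y, G.shift d x = y → (movedMap G d).rot y = G.shift d (G.rot x) := by
    rintro x _ rfl
    simp [movedMap]
  have hv := hd.vertexOf_side_injective
  rw [← ht] at hv
  have hr : ∀ i, G.rot (G.rot (G.rot (t (i + 1)))) = G.rev (t i) := fun i => by
    apply G.rot.injective
    rw [G.rot_four, ← G.next_apply, hd.next_side]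
  have hsr : ∀ i, G.shift d (G.rev (t i)) = G.rev (t i) := fun i => by
    rw [← hr]
    refine shift_other (fun j hj => ?_) (fun j hj => ?_)
    · have hjj : G.rot (G.rot (t (i + 1))) = t j := G.rot.injective hj
      have := hv (i + 1) j (by rw [← hjj, vertexOf_rot, vertexOf_rot])
      subst this
      exact G.rot_two_ne _ hjj
    · have hjj : G.rot (t (i + 1)) = t j := G.rot.injective (G.rot.injective hj)
      have := hv (i + 1) j (by rw [← hjj, vertexOf_rot])
      subst this
      exact G.rot_ne _ hjj
  have hst : ∀ i, G.shift d (t i) = t i := fun i => by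
    refine shift_other (fun j hj => ?_) (fun j hj => ?_)
    · have := hv i j (by rw [hj, vertexOf_rot])
      subst this
      exact G.rot_ne _ hj.symm
    · have := hv i j (by rw [hj, vertexOf_rot, vertexOf_rot])
      subst this
      exact G.rot_two_ne _ hj.symm
  have hso : ∀ x, (∀ i, G.vertexOf x ≠ G.vertexOf (t i)) → G.shift d x = x := fun x hx =>
    shift_other (fun j hj => hx j (by rw [hj, vertexOf_rot]))
      (fun j hj => hx j (by rw [hj, vertexOf_rot, vertexOf_rot]))
  refine ⟨hd.next_side, hv, rfl, ⟨_, rfl⟩, fun i => ?_, fun i => ?_, fun i => ?_, fun i => ?_,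
    fun x hx => ?_⟩
  · rw [hrot _ _ (hst i), hd.shift_u]
  · rw [hrot _ _ (hd.shift_u i), hd.shift_w]
  · rw [hrot _ _ (hd.shift_w (i + 1)), hr, hsr]
  · rw [hrot _ _ (hsr i), ← G.next_apply, hd.next_side, hst]
  · rw [hrot _ _ (hso x hx), hso _ fun i => by rw [vertexOf_rot]; exact hx i]

omit [DecidableEq D] in
theorem isSide_of_eq {e : D} {i : Fin 3} (h : e = triangleSide G.toFourValentMap d i ∨
    e = G.rev (triangleSide G.toFourValentMap d i)) : G.IsSide d e := by
  unfold IsSide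
  fin_cases i
  · rcases h with h | h
    · exact Or.inl h
    · exact Or.inr (Or.inr (Or.inr (Or.inl h)))
  · rcases h with h | h
    · exact Or.inr (Or.inl h)
    · exact Or.inr (Or.inr (Or.inr (Or.inr (Or.inl h))))
  · rcases h with h | h
    · exact Or.inr (Or.inr (Or.inl h))
    · exact Or.inr (Or.inr (Or.inr (Or.inr (Or.inr h))))

/-- Every simple triangle can be moved. -/
theorem IsTriangle.exists_move [Finite D] (hd : G.IsTriangle d) {o : D} (ho : G.faceOf o = G.outer)
    (hot : ∀ i, o ≠ G.rev (triangleSide G.toFourValentMap d i)) :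
    ∃ H : PlaneFourValentGraph D, G.TriangleMoveAt H d ∧
      H.toFourValentMap = movedMap G d ∧ H.faceOf o = H.outer := by
  refine ⟨⟨movedMap G d, hd.isMove.connected G.connected, hd.isMove.spherical G.spherical,
    (movedMap G d).faceOf o⟩, ⟨hd, rfl, rfl, fun e he => ?_⟩, rfl, rfl⟩
  rw [← ho]
  exact hd.isMove.faceOf_eq_iff (fun i hi => he (isSide_of_eq (Or.inr hi))) hot

/-- A lens in a graph without loop configurations shrinks under triangle moves to a bigon. -/
theorem exists_bigon_of_lens [Finite D] (n : ℕ) : ∀ (G : PlaneFourValentGraph D) (o : D) (S : Set D),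
    S.ncard = n → (¬ ∃ d, G.IsLoop d) → G.faceOf o = G.outer → G.IsMinimalLens o S →
    ∃ H : PlaneFourValentGraph D, Relation.ReflTransGen TriangleMove G H ∧ ∃ d, H.IsBigon d := by
  induction n using Nat.strong_induction_on with
  | _ n ih =>
  intro G o S hn hloop ho hS
  by_cases hbig : ∃ d, G.IsBigon d
  · exact ⟨G, Relation.ReflTransGen.refl, hbig⟩
  have hout : ∀ d ∈ S, G.faceOf d ≠ G.outer := fun d hd => by
    rw [← ho]; exact notMem_of_faceOf_eq hS.region hS.notMem hd
  obtain ⟨d, hd, hrd, h3, v1, v2, v3⟩ := hS.exists_triangle G.connected G.spherical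
    (fun d hd hnd => hloop ⟨d, hnd, hout d hd⟩)
    (fun d hd hnd => by_contra fun hv => hbig ⟨d, hnd, hv, hout d hd⟩)
  have htri : G.IsTriangle d := ⟨h3, v1, v2, v3, hout d hd⟩
  have hm := htri.isMove
  set t := triangleSide G.toFourValentMap d with ht
  have htS : ∀ i, t i ∈ S := by
    intro i
    fin_cases i
    · exact hd
    · exact (hS.region _).2 hd
    · exact (hS.region _).2 ((hS.region _).2 hd)
  -- Reversed sides change their face in the move, so the unbounded face has to be marked by another
  -- dart; the next dart on the same face will do.
  obtain ⟨o', ho', ho'S, ho't⟩ : ∃ o', G.faceOf o' = G.outer ∧ o' ∉ S ∧ ∀ i, o' ≠ G.rev (t i) := by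
    by_cases hex : ∃ i, o = G.rev (t i)
    · obtain ⟨i, hi⟩ := hex
      have hf : G.faceOf (G.rot (t i)) = G.faceOf o := by
        rw [hi, ← next_rev, faceOf_next]
      refine ⟨G.rot (t i), hf.trans ho, ?_, fun j => hm.u_ne_r i j⟩
      rw [hS.region.mem_iff_of_faceOf_eq hf]
      exact hS.notMem
    · push Not at hex
      exact ⟨o, ho, hS.notMem, hex⟩
  obtain ⟨H, hH, hHG, hHo⟩ := htri.exists_move ho' ho't
  rw [← hHG] at hm
  have hloopH : ¬ ∃ e, H.IsLoop e := by
    rintro ⟨e, he, heo⟩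
    obtain ⟨er, -, hcase⟩ := hm.loop_cases he
    have heo' : G.faceOf e ≠ G.outer := by
      rwa [← ho', ne_eq, ← hm.faceOf_eq_iff er ho't, hHo]
    rcases hcase with h | ⟨h, hv⟩
    · exact hloop ⟨e, h, heo'⟩
    · exact hbig ⟨e, h, hv, heo'⟩
  have hsub := hm.moved_subset hS.convex htS
  have hle := (hm.ncard_corners_moved_le hS.region hS.convex htS).trans hS.ncard_corners
  have hconv := hm.isConvex_moved hS.region hS.convex htS (k := 0) hrd
  have hlt := hm.moved_ncard_lt hS.convex htS
  have hreg := hm.isRegion_moved hS.region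
  have hne := hm.moved_nonempty hS.region htS hS.ncard_corners
  have hdisc : H.IsDisc o' (IsMove.moved G.toFourValentMap t S) :=
    ⟨hreg, hconv, hne, hm.isCoconnected_moved hS.convex htS hS.coconnected (k := 0) hrd,
      fun h => ho'S (hsub h)⟩
  obtain ⟨S', hS', hcard⟩ := exists_isMinimalLens hreg hconv hne hdisc.notMem hle
  -- The remainder is already a disc, so filling adds nothing and the new minimal lens has fewer
  -- darts than `S`.
  have hfill := Set.ncard_le_ncard (fill_subset hdisc subset_rfl)
  obtain ⟨K, hHK, hK⟩ := ih S'.ncard (by omega) H o' S' rfl hloopH hHo hS'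
  exact ⟨K, Relation.ReflTransGen.head ⟨d, hH⟩ hHK, hK⟩

end

end PlaneFourValentGraph

theorem lemma2 {D : Type*} [Fintype D] [DecidableEq D] (G : PlaneFourValentGraph D)
    (hvertex : Nonempty G.Vertex)
    (hloop : ¬ ∃ d, G.IsLoop d) (hbigon : ¬ ∃ d, G.IsBigon d) :
    ∃ H : PlaneFourValentGraph D,
      Relation.ReflTransGen PlaneFourValentGraph.TriangleMove G H ∧ ∃ d, H.IsBigon d := by
  obtain ⟨o, ho⟩ := G.faceOf_surjective G.outer
  -- Any strand yields a lens; the strand of `o` itself serves.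
  obtain ⟨X, h1, h2, h3, h4, h5, -⟩ := G.exists_convex_of_strand G.connected G.spherical o o
  obtain ⟨S, hS, -⟩ := FourValentMap.exists_isMinimalLens h1 h2 h3 h5 (by omega)
  exact PlaneFourValentGraph.exists_bigon_of_lens S.ncard G o S rfl hloop ho hS
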